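/- **Setting.** Blocks are found one after the other; each block is found, independently of all others, by a selfish miner (the attacker, $S$) with probability $q$ or by the honest miners ($H$) with probability $p=1-q$, where $0\le q<1/2$. Every block has one parent, and its height is one more than that of its parent. Let $\gamma\in[0,1]$ and let $n_1\ge 1$ be an integer. **Strategy 1.** At the start of an attack cycle everyone agrees on the tip of the official blockchain. The attacker mines a secret fork on it. Each time the honest miners find a block without ending the cycle, he publishes his fork up to the height of that block; while two public branches of equal height compete, the next honest block is mined on the attacker's published branch with probability $\gamma$ and on the honest branch with probability $1-\gamma$, independently of everything else. The attack cycle ends * when the honest miners find a block higher than the attacker's fork (cycles $H$ and $SHH$); this block is then the new official tip; * when, after an honest block, the attacker's lead has fallen from two blocks to one: he publishes his whole fork, which becomes official (cycles $SSwH$ with $w$ a Dyck word); * when the attacker finds a block while the fully published fork and the honest branch have equal height: he publishes it and his fork becomes official (cycle $SHS$). The next attack cycle then starts. An *uncle* is a block outside the official blockchain whose parent belongs to it. All miners signal as much as possible: a new block $N$ refers to every block $u$ that is not on its chain, whose parent is on its chain, whose distance to $N$ (height of $N$ minus height of $u$) is between $1$ and $n_1$, and that was not referred to by an ancestor of $N$;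 there is no bound on the number of references of a block. A *nephew* of an uncle is an official block that refers to it. **Statement.** Consider any attack cycle $\omega$ in the infinite sequence of cycles. Let $U_h$ be the number of uncles created during $\omega$ that are referred to by a nephew mined by the honest miners (in $\omega$ or later), and let $V$ be the number of uncles created during $\omega$ that are referred to by a nephew (honest or not) in an attack cycle strictly after $\omega$. Then $U_h$ and $V$ are integrable, $$\mathbb E[V]=\frac{q^2}{p}\,\bigl(1-q^{n_1-1}\bigr)\gamma+(1-\gamma)\,pq^2\,\frac{1-(pq)^{n_1-1}}{1-pq},$$ and $$\mathbb E[U_h]=p^2q+\bigl(p+(1-\gamma)p^2q\bigr)\,\mathbb E[V].$$ -/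

import Mathlib

open MeasureTheory ProbabilityTheory

namespace SelfishMining

/-- The two kinds of miners: the attacker (`S`) and the honest miners (`H`). -/
inductive Miner : Type
  | selfish
  | honest

instance : MeasurableSpace Miner := ⊤

/-- Blocks are named by natural numbers: `0` is the genesis block and `t + 1` is the block found by
the `t`-th mining event. `refs` is the set of the orphan blocks which the block signals. -/
structure Block : Type where
  parent : ℕ
  height : ℕ
  miner : Miner
  refs : Set ℕ

/-- A mining event: who finds the next block, and a coin which says whether an honest finder is one
of those who, during a competition between two public branches of equal height, mine on
top of the branch of the attacker. -/
abbrev Event : Type := Miner × Bool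

/-- All blocks found so far (`block i` for `i < size`), the tip of the fork of the attacker and the
tip of the branch of the honest miners. The two tips are equal exactly when everyone agrees on the
official blockchain, that is, between two attack cycles. -/
structure State : Type where
  block : ℕ → Block
  size : ℕ
  secretTip : ℕ
  honestTip : ℕ

namespace State

def init : State where
  block := fun _ => ⟨0, 0, Miner.honest, ∅⟩
  size := 1
  secretTip := 0
  honestTip := 0

/-- The parent function on block names. -/
def parent (s : State) (b : ℕ) : ℕ := (s.block b).parent

def height (s : State) (b : ℕ) : ℕ := (s.block b).height

/-- `a` is `b` or one of its ancestors. -/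
def IsAncestor (s : State) (a b : ℕ) : Prop := ∃ k : ℕ, s.parent^[k] b = a

/-- The block of the fork of the attacker which has the same height as the tip of the honest branch.
The attacker has made public his fork up to this block. Outside of a
competition it is the honest tip itself. -/
def publishedTip (s : State) : ℕ :=
  s.parent^[s.height s.secretTip - s.height s.honestTip] s.secretTip

/-- The blocks signaled by a new block on top of `par`, when blocks can be signaled up to distance
`n₁`: all blocks `u` off the chain of `par` whose parent is on it, whose distance (the
difference of the heights) to the new block is between `1` and `n₁`, and which have not been signaled
on that chain before. (Under the strategy below, all blocks lower than
a new honest block are already public, so that honest miners see all of them.) -/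
def signaled (n₁ : ℕ) (s : State) (par : ℕ) : Set ℕ :=
  {u | u < s.size ∧ ¬ s.IsAncestor u par ∧ s.IsAncestor (s.parent u) par ∧
    s.height u < s.height par + 1 ∧ s.height par + 1 ≤ s.height u + n₁ ∧
    ∀ a, s.IsAncestor a par → u ∉ (s.block a).refs}

/-- The table of blocks after `m` has found a block on top of `par`. -/
noncomputable def addBlock (n₁ : ℕ) (s : State) (m : Miner) (par : ℕ) : ℕ → Block :=
  Function.update s.block s.size ⟨par, s.height par + 1, m, s.signaled n₁ par⟩

/-- One mining event when the attacker follows Strategy 1.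

If the attacker finds the block, it extends his fork; if his fork was in an open competition with an
honest branch of equal height, he publishes his block, wins, and the cycle ends.

If the honest miners find the block, it is mined on `publishedTip` or on `honestTip` according to
the coin (these coincide outside of a competition). If the new
block is higher than the fork of the attacker, everyone adopts it and the cycle ends. If the lead of
the attacker is now one block, he publishes his whole fork, wins, and the cycle ends.
Otherwise he publishes his fork up to the height of the new block, and the cycle goes on. -/
noncomputable def step (n₁ : ℕ) (s : State) : Event → State
  | (Miner.selfish, _) =>
    { block := s.addBlock n₁ Miner.selfish s.secretTip
      size := s.size + 1
      secretTip := s.size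
      honestTip :=
        if s.secretTip ≠ s.honestTip ∧ s.height s.secretTip = s.height s.honestTip then s.size
        else s.honestTip }
  | (Miner.honest, coin) =>
    let par : ℕ := if coin = true then s.publishedTip else s.honestTip
    let h : ℕ := s.height par + 1
    { block := s.addBlock n₁ Miner.honest par
      size := s.size + 1
      secretTip := if s.height s.secretTip < h then s.size else s.secretTip
      honestTip := if h + 1 = s.height s.secretTip then s.secretTip else s.size }

end State

/-- The state after the first `t` mining events of the trajectory `e`. -/
noncomputable def state (n₁ : ℕ) (e : ℕ → Event) : ℕ → State
  | 0 => State.init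
  | t + 1 => (state n₁ e t).step n₁ (e t)

/-- The data of block `b`; it is present from the `b`-th state on and never changes. -/
noncomputable def blockOf (n₁ : ℕ) (e : ℕ → Event) (b : ℕ) : Block := (state n₁ e b).block b

/-- Block `b` belongs to the official blockchain: it is on the chain adopted by everyone at the end
of some attack cycle. -/
def IsOfficial (n₁ : ℕ) (e : ℕ → Event) (b : ℕ) : Prop :=
  ∃ t, (state n₁ e t).honestTip = (state n₁ e t).secretTip ∧
    (state n₁ e t).IsAncestor b (state n₁ e t).secretTip

/-- An uncle is an orphan block whose parent belongs to the official blockchain. -/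
def IsUncle (n₁ : ℕ) (e : ℕ → Event) (u : ℕ) : Prop :=
  1 ≤ u ∧ ¬ IsOfficial n₁ e u ∧ IsOfficial n₁ e (blockOf n₁ e u).parent

/-- The (zero-based) index of the attack cycle in which block `b ≥ 1` is found: the number of attack
cycles that ended before. -/
noncomputable def cycleOf (n₁ : ℕ) (e : ℕ → Event) (b : ℕ) : ℕ :=
  ((Finset.Ico 1 b).filter fun t =>
    (state n₁ e t).honestTip = (state n₁ e t).secretTip).card

/-- `N` is a nephew of the uncle `u`: an official block which refers to `u`. -/
def IsNephew (n₁ : ℕ) (e : ℕ → Event) (N u : ℕ) : Prop :=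
  IsUncle n₁ e u ∧ 1 ≤ N ∧ IsOfficial n₁ e N ∧ u ∈ (blockOf n₁ e N).refs

/-- `U_h`: the number of uncles created during cycle `n` that are referred by a nephew mined by the
honest miners (in cycle `n` or later). -/
noncomputable def honestReferredUncles (n₁ n : ℕ) (e : ℕ → Event) : ℕ :=
  {u | cycleOf n₁ e u = n ∧
    ∃ N, IsNephew n₁ e N u ∧ (blockOf n₁ e N).miner = Miner.honest}.ncard

/-- `V`: the number of uncles created during cycle `n` that are referred by a nephew (honest or not)
in an attack cycle strictly after `n`. -/
noncomputable def laterReferredUncles (n₁ n : ℕ) (e : ℕ → Event) : ℕ :=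
  {u | cycleOf n₁ e u = n ∧ ∃ N, IsNephew n₁ e N u ∧ n < cycleOf n₁ e N}.ncard

/-- The law of the mining events: they are independent and identically distributed, the finder is
the attacker with probability `q` (otherwise the honest miners), and the independent coin is `true`
with probability `γ`. -/
noncomputable def miningLaw (q γ : unitInterval) : Measure (ℕ → Event) :=
  Measure.infinitePi fun _ : ℕ =>
    (bernoulliMeasure Miner.selfish Miner.honest q).prod (bernoulliMeasure true false γ)

end SelfishMining

/-! ### The tree of all blocks: parents, heights, ancestors -/

namespace SelfishMining

variable {n₁ : ℕ} {e : ℕ → Event}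

/-! The official blocks form a single chain. An uncle is therefore referred to by exactly one
candidate, the first official block that is both younger and higher than it, and only if the
distance is at most `n₁` (`mem_refs_iff_of_isUncle`). Every block of a finished cycle is at most as
high as the new official tip, so a nephew in a later cycle can only be the first official block of
the next cycle (`IsCycle.isNephew_iff`). Hence `V` is the number of uncles still pending when the
cycle ends. `U_h` is the number of uncles with an honest nephew inside the cycle (one for `SHH`,
none otherwise), plus `V` if the next cycle's first official block is honest.

All of this can be read off a Markov chain of phases (`phaseSpec_next`, `exists_summarySpec`). In a
long fork an attacker block is higher than every earlier block, so it leaves no uncle pending; only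
honest blocks of the final run of the cycle count. An honest block found at lead `i + 2` has
distance `i + 2` to the next official block. Its parent is on the fork if it is the first honest
block of the cycle or if its coin is `true`: with conditional probability `γ + (1 - γ) * [first]`.
The `γ` part sums the probabilities `q ^ j` that the final run has at least `j + 1` blocks; the `1 -
γ` part sums the probabilities of the cycles `S^(l+2) H^(l+1)`. Both are geometric sums.

The next cycle starts with an honest official block with probability `p + (1 - γ) p² q` (cycles `H`,
and `SHH` with the third block on the honest branch), independently of the past; this gives the
product in the formula for `U_h`.

The expectations are computed by harmonic functions of the chain (`eventMean_laterMean`,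
`eventMean_honestMean`). They give bounded martingales that are eventually constant, since cycles
end almost surely when `q < 1/2` (`ae_exists_cycle`); dominated convergence identifies the mean with
the initial value (`integral_eq_of_harmonic`). -/

/-- The block on top of which the next block is mined. -/
noncomputable def State.target (s : State) : Event → ℕ
  | (Miner.selfish, _) => s.secretTip
  | (Miner.honest, coin) => if coin = true then s.publishedTip else s.honestTip

theorem State.step_block (n₁ : ℕ) (s : State) (ev : Event) :
    (s.step n₁ ev).block = s.addBlock n₁ ev.1 (s.target ev) := by
  obtain ⟨_ | _, c⟩ := ev <;> rfl

theorem State.step_size (n₁ : ℕ) (s : State) (ev : Event) :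
    (s.step n₁ ev).size = s.size + 1 := by
  obtain ⟨_ | _, c⟩ := ev <;> rfl

theorem state_size (n₁ : ℕ) (e : ℕ → Event) (t : ℕ) : (state n₁ e t).size = t + 1 := by
  induction t with
  | zero => rfl
  | succ t ih => rw [state, State.step_size, ih]

theorem state_block_eq {b t : ℕ} (h : b ≤ t) : (state n₁ e t).block b = blockOf n₁ e b := by
  induction t, h using Nat.le_induction with
  | base => rfl
  | succ t h ih =>
    rw [state, State.step_block, State.addBlock, Function.update_of_ne, ih]
    rw [state_size]
    omega

/-- The parent of a block. -/
noncomputable def parentOf (n₁ : ℕ) (e : ℕ → Event) (b : ℕ) : ℕ := (blockOf n₁ e b).parent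

/-- The height of a block. -/
noncomputable def heightOf (n₁ : ℕ) (e : ℕ → Event) (b : ℕ) : ℕ := (blockOf n₁ e b).height

/-- The tip of the fork of the attacker after `t` events. -/
noncomputable def secretAt (n₁ : ℕ) (e : ℕ → Event) (t : ℕ) : ℕ := (state n₁ e t).secretTip

/-- The tip of the honest branch after `t` events. -/
noncomputable def honestAt (n₁ : ℕ) (e : ℕ → Event) (t : ℕ) : ℕ := (state n₁ e t).honestTip

/-- The tip of the published part of the fork after `t` events. -/
noncomputable def publishedAt (n₁ : ℕ) (e : ℕ → Event) (t : ℕ) : ℕ := (state n₁ e t).publishedTip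

/-- `a` is `b` or one of its ancestors. -/
def Anc (n₁ : ℕ) (e : ℕ → Event) (a b : ℕ) : Prop := ∃ k : ℕ, (parentOf n₁ e)^[k] b = a

/-- After `t` events everyone agrees on the official blockchain. -/
def Agreed (n₁ : ℕ) (e : ℕ → Event) (t : ℕ) : Prop := honestAt n₁ e t = secretAt n₁ e t

theorem blockOf_succ (n₁ : ℕ) (e : ℕ → Event) (t : ℕ) :
    blockOf n₁ e (t + 1) = ⟨(state n₁ e t).target (e t),
      (state n₁ e t).height ((state n₁ e t).target (e t)) + 1, (e t).1,
      (state n₁ e t).signaled n₁ ((state n₁ e t).target (e t))⟩ := by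
  rw [blockOf, state, State.step_block, State.addBlock, ← state_size n₁ e t, Function.update_self]

theorem blockOf_zero (n₁ : ℕ) (e : ℕ → Event) :
    blockOf n₁ e 0 = ⟨0, 0, Miner.honest, ∅⟩ := rfl

@[simp] theorem parentOf_zero (n₁ : ℕ) (e : ℕ → Event) : parentOf n₁ e 0 = 0 := rfl

@[simp] theorem heightOf_zero (n₁ : ℕ) (e : ℕ → Event) : heightOf n₁ e 0 = 0 := rfl

theorem state_parent_eq {b t : ℕ} (h : b ≤ t) : (state n₁ e t).parent b = parentOf n₁ e b := by
  rw [State.parent, state_block_eq h, parentOf]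

theorem state_height_eq {b t : ℕ} (h : b ≤ t) : (state n₁ e t).height b = heightOf n₁ e b := by
  rw [State.height, state_block_eq h, heightOf]

/-- The bounds need a joint induction: the published tip is reached by iterating parents, which
stays among the existing blocks only if parents have smaller names, and the parent of a new block is
one of the tips. -/
theorem secretAt_le_and (n₁ : ℕ) (e : ℕ → Event) (t : ℕ) :
    secretAt n₁ e t ≤ t ∧ honestAt n₁ e t ≤ t ∧ publishedAt n₁ e t ≤ t ∧
      (∀ b ≤ t, parentOf n₁ e b ≤ b) ∧ (state n₁ e t).target (e t) ≤ t := by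
  have iter : ∀ t, secretAt n₁ e t ≤ t → (∀ b ≤ t, parentOf n₁ e b ≤ b) →
      publishedAt n₁ e t ≤ t := by
    intro t hs hp
    have : ∀ k, ((state n₁ e t).parent^[k] (secretAt n₁ e t)) ≤ t := by
      intro k
      induction k with
      | zero => exact hs
      | succ k ih =>
        rw [Function.iterate_succ_apply', state_parent_eq ih]
        exact (hp _ ih).trans ih
    exact this _
  have tgt : ∀ t, secretAt n₁ e t ≤ t → honestAt n₁ e t ≤ t → publishedAt n₁ e t ≤ t →
      (state n₁ e t).target (e t) ≤ t := by
    intro t h1 h2 h3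
    rcases he : e t with ⟨_ | _, _ | _⟩
    exacts [h1, h1, h2, h3]
  have main : secretAt n₁ e t ≤ t ∧ honestAt n₁ e t ≤ t ∧ ∀ b ≤ t, parentOf n₁ e b ≤ b := by
    induction t with
    | zero =>
      refine ⟨le_rfl, le_rfl, ?_⟩
      intro b hb
      obtain rfl : b = 0 := by omega
      simp
    | succ t ih =>
      obtain ⟨h1, h2, h4⟩ := ih
      have h3 := iter t h1 h4
      have h5 := tgt t h1 h2 h3
      have hsz := state_size n₁ e t
      unfold secretAt honestAt at *
      refine ⟨?_, ?_, ?_⟩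
      · rw [state]
        rcases he : e t with ⟨_ | _, c⟩ <;> simp only [State.step]
        · omega
        · split_ifs <;> omega
      · rw [state]
        rcases he : e t with ⟨_ | _, c⟩ <;> simp only [State.step]
        · split_ifs <;> omega
        · split_ifs <;> omega
      · intro b hb
        rcases Nat.lt_or_ge t b with h | h
        · obtain rfl : b = t + 1 := by omega
          rw [parentOf, blockOf_succ]
          exact h5.trans (Nat.le_succ t)
        · exact h4 b h
  obtain ⟨h1, h2, h4⟩ := main
  exact ⟨h1, h2, iter t h1 h4, h4, tgt t h1 h2 (iter t h1 h4)⟩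

theorem secretAt_le (n₁ : ℕ) (e : ℕ → Event) (t : ℕ) : secretAt n₁ e t ≤ t :=
  (secretAt_le_and n₁ e t).1

theorem honestAt_le (n₁ : ℕ) (e : ℕ → Event) (t : ℕ) : honestAt n₁ e t ≤ t :=
  (secretAt_le_and n₁ e t).2.1

theorem parentOf_le (n₁ : ℕ) (e : ℕ → Event) (b : ℕ) : parentOf n₁ e b ≤ b :=
  (secretAt_le_and n₁ e b).2.2.2.1 b le_rfl

theorem target_le (n₁ : ℕ) (e : ℕ → Event) (t : ℕ) : (state n₁ e t).target (e t) ≤ t :=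
  (secretAt_le_and n₁ e t).2.2.2.2

theorem parentOf_succ (n₁ : ℕ) (e : ℕ → Event) (t : ℕ) :
    parentOf n₁ e (t + 1) = (state n₁ e t).target (e t) := by
  rw [parentOf, blockOf_succ]

theorem parentOf_succ_le (n₁ : ℕ) (e : ℕ → Event) (t : ℕ) : parentOf n₁ e (t + 1) ≤ t := by
  rw [parentOf_succ]
  exact target_le n₁ e t

theorem parentOf_lt {b : ℕ} (hb : 1 ≤ b) : parentOf n₁ e b < b := by
  obtain ⟨t, rfl⟩ : ∃ t, b = t + 1 := ⟨b - 1, by omega⟩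
  exact Nat.lt_succ_of_le (parentOf_succ_le n₁ e t)

theorem heightOf_succ (n₁ : ℕ) (e : ℕ → Event) (t : ℕ) :
    heightOf n₁ e (t + 1) = heightOf n₁ e (parentOf n₁ e (t + 1)) + 1 := by
  rw [parentOf_succ, heightOf, blockOf_succ]
  simp only [state_height_eq (target_le n₁ e t)]

theorem heightOf_eq {b : ℕ} (hb : 1 ≤ b) :
    heightOf n₁ e b = heightOf n₁ e (parentOf n₁ e b) + 1 := by
  obtain ⟨t, rfl⟩ : ∃ t, b = t + 1 := ⟨b - 1, by omega⟩
  exact heightOf_succ n₁ e t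

theorem minerOf_succ (n₁ : ℕ) (e : ℕ → Event) (t : ℕ) :
    (blockOf n₁ e (t + 1)).miner = (e t).1 := by
  rw [blockOf_succ]

theorem state_parent_iterate {b t : ℕ} (h : b ≤ t) (k : ℕ) :
    (state n₁ e t).parent^[k] b = (parentOf n₁ e)^[k] b ∧ (parentOf n₁ e)^[k] b ≤ b := by
  induction k with
  | zero => exact ⟨rfl, le_rfl⟩
  | succ k ih =>
    rw [Function.iterate_succ_apply', Function.iterate_succ_apply', ih.1,
      state_parent_eq (ih.2.trans h)]
    exact ⟨rfl, (parentOf_le _ _ _).trans ih.2⟩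

theorem isAncestor_iff {b t : ℕ} (h : b ≤ t) (a : ℕ) :
    (state n₁ e t).IsAncestor a b ↔ Anc n₁ e a b := by
  unfold State.IsAncestor Anc
  simp only [(state_parent_iterate h _).1]

theorem Anc.refl (n₁ : ℕ) (e : ℕ → Event) (b : ℕ) : Anc n₁ e b b := ⟨0, rfl⟩

theorem Anc.trans {a b c : ℕ} (h : Anc n₁ e a b) (h' : Anc n₁ e b c) : Anc n₁ e a c := by
  obtain ⟨k, rfl⟩ := h
  obtain ⟨l, rfl⟩ := h'
  exact ⟨k + l, Function.iterate_add_apply _ _ _ _⟩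

theorem Anc.le {a b : ℕ} (h : Anc n₁ e a b) : a ≤ b := by
  obtain ⟨k, rfl⟩ := h
  exact (state_parent_iterate le_rfl k).2

theorem anc_zero {a : ℕ} : Anc n₁ e a 0 ↔ a = 0 :=
  ⟨fun h => Nat.le_zero.1 h.le, fun h => h ▸ Anc.refl _ _ _⟩

theorem anc_iff {a b : ℕ} : Anc n₁ e a b ↔ a = b ∨ Anc n₁ e a (parentOf n₁ e b) := by
  constructor
  · rintro ⟨_ | k, h⟩
    · exact Or.inl h.symm
    · exact Or.inr ⟨k, h⟩
  · rintro (rfl | ⟨k, h⟩)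
    · exact Anc.refl _ _ _
    · exact ⟨k + 1, h⟩

theorem anc_parentOf (n₁ : ℕ) (e : ℕ → Event) (b : ℕ) : Anc n₁ e (parentOf n₁ e b) b := ⟨1, rfl⟩

theorem Anc.heightOf_le {a b : ℕ} (h : Anc n₁ e a b) : heightOf n₁ e a ≤ heightOf n₁ e b := by
  induction b using Nat.strong_induction_on with
  | _ b ih =>
    rcases anc_iff.1 h with rfl | h'
    · exact le_rfl
    · rcases Nat.eq_zero_or_pos b with rfl | hb
      · rw [anc_zero.1 h]
      · rw [heightOf_eq hb]
        exact (ih _ (parentOf_lt hb) h').trans (Nat.le_succ _)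

theorem Anc.total {a b c : ℕ} (ha : Anc n₁ e a c) (hb : Anc n₁ e b c) :
    Anc n₁ e a b ∨ Anc n₁ e b a := by
  obtain ⟨k, rfl⟩ := ha
  obtain ⟨l, rfl⟩ := hb
  rcases le_total k l with h | h
  · right
    exact ⟨l - k, by rw [← Function.iterate_add_apply, Nat.sub_add_cancel h]⟩
  · left
    exact ⟨k - l, by rw [← Function.iterate_add_apply, Nat.sub_add_cancel h]⟩

theorem Anc.eq_of_heightOf_le {a b : ℕ} (h : Anc n₁ e a b)
    (hh : heightOf n₁ e b ≤ heightOf n₁ e a) : a = b := by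
  rcases anc_iff.1 h with rfl | h'
  · rfl
  · rcases Nat.eq_zero_or_pos b with rfl | hb
    · exact anc_zero.1 h
    · have := h'.heightOf_le
      rw [heightOf_eq hb] at hh
      omega

theorem Anc.of_heightOf_le {a b c : ℕ} (ha : Anc n₁ e a c) (hb : Anc n₁ e b c)
    (hh : heightOf n₁ e a ≤ heightOf n₁ e b) : Anc n₁ e a b := by
  rcases ha.total hb with h | h
  · exact h
  · rw [h.eq_of_heightOf_le hh]
    exact Anc.refl _ _ _

theorem Anc.of_le {a b c : ℕ} (ha : Anc n₁ e a c) (hb : Anc n₁ e b c) (hh : a ≤ b) :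
    Anc n₁ e a b := by
  rcases ha.total hb with h | h
  · exact h
  · rw [le_antisymm hh h.le]
    exact Anc.refl _ _ _

theorem Anc.heightOf_lt {a b : ℕ} (h : Anc n₁ e a b) (hab : a < b) :
    heightOf n₁ e a < heightOf n₁ e b := by
  by_contra! hh
  exact hab.ne (h.eq_of_heightOf_le hh)

/-- The genesis block has height `0` and is its own parent, so truncated subtraction is right even
when the iteration runs past it. -/
theorem heightOf_iterate (b k : ℕ) :
    heightOf n₁ e ((parentOf n₁ e)^[k] b) = heightOf n₁ e b - k := by
  induction k with
  | zero => rfl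
  | succ k ih =>
    rw [Function.iterate_succ_apply']
    rcases Nat.eq_zero_or_pos ((parentOf n₁ e)^[k] b) with h | h
    · rw [h] at ih ⊢
      simp at ih ⊢
      omega
    · have := heightOf_eq (n₁ := n₁) (e := e) h
      omega

theorem mem_refs_iff {N u : ℕ} (hN : 1 ≤ N) :
    u ∈ (blockOf n₁ e N).refs ↔ u < N ∧ ¬ Anc n₁ e u (parentOf n₁ e N) ∧
      Anc n₁ e (parentOf n₁ e u) (parentOf n₁ e N) ∧ heightOf n₁ e u < heightOf n₁ e N ∧
      heightOf n₁ e N ≤ heightOf n₁ e u + n₁ ∧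
      ∀ a, Anc n₁ e a (parentOf n₁ e N) → u ∉ (blockOf n₁ e a).refs := by
  obtain ⟨t, rfl⟩ : ∃ t, N = t + 1 := ⟨N - 1, by omega⟩
  have hP := parentOf_succ_le n₁ e t
  rw [heightOf_succ, blockOf_succ, ← parentOf_succ]
  simp only [State.signaled, Set.mem_ofPred_eq, state_size, isAncestor_iff hP, state_height_eq hP]
  refine and_congr_right fun hu => ?_
  have hu' : u ≤ t := by omega
  rw [state_parent_eq hu', state_height_eq hu']
  refine and_congr_right fun _ => and_congr_right fun _ => and_congr_right fun _ =>
    and_congr_right fun _ => forall_congr' fun a => ?_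
  constructor
  · intro h ha
    have := h ha
    rwa [state_block_eq (ha.le.trans hP)] at this
  · intro h ha
    rw [state_block_eq (ha.le.trans hP)]
    exact h ha

/-! ### Effect of one mining event on the tips -/

theorem publishedAt_eq (n₁ : ℕ) (e : ℕ → Event) (t : ℕ) :
    publishedAt n₁ e t = (parentOf n₁ e)^[heightOf n₁ e (secretAt n₁ e t) -
      heightOf n₁ e (honestAt n₁ e t)] (secretAt n₁ e t) := by
  have h1 := secretAt_le n₁ e t
  have h2 := honestAt_le n₁ e t
  rw [publishedAt, State.publishedTip]
  unfold secretAt honestAt at *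
  rw [(state_parent_iterate h1 _).1, state_height_eq h1, state_height_eq h2]

theorem anc_publishedAt (n₁ : ℕ) (e : ℕ → Event) (t : ℕ) :
    Anc n₁ e (publishedAt n₁ e t) (secretAt n₁ e t) := ⟨_, (publishedAt_eq n₁ e t).symm⟩

theorem step_selfish {t : ℕ} {c : Bool} (he : e t = (Miner.selfish, c)) :
    parentOf n₁ e (t + 1) = secretAt n₁ e t ∧ secretAt n₁ e (t + 1) = t + 1 ∧
      (honestAt n₁ e t ≠ secretAt n₁ e t →
        heightOf n₁ e (secretAt n₁ e t) = heightOf n₁ e (honestAt n₁ e t) →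
        honestAt n₁ e (t + 1) = t + 1) ∧
      (¬ (honestAt n₁ e t ≠ secretAt n₁ e t ∧
        heightOf n₁ e (secretAt n₁ e t) = heightOf n₁ e (honestAt n₁ e t)) →
        honestAt n₁ e (t + 1) = honestAt n₁ e t) := by
  have h1 := secretAt_le n₁ e t
  have h2 := honestAt_le n₁ e t
  have h3 := state_size n₁ e t
  rw [parentOf_succ]
  unfold secretAt honestAt at *
  rw [state, he]
  simp only [State.step, State.target, state_height_eq h1, state_height_eq h2, h3, true_and]
  constructor
  · intro h h'
    rw [if_pos ⟨h.symm, h'⟩]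
  · intro h
    rw [if_neg fun h' => h ⟨h'.1.symm, h'.2⟩]

theorem step_honest {t : ℕ} {c : Bool} (he : e t = (Miner.honest, c)) :
    parentOf n₁ e (t + 1) = (if c = true then publishedAt n₁ e t else honestAt n₁ e t) ∧
      secretAt n₁ e (t + 1) = (if heightOf n₁ e (secretAt n₁ e t) < heightOf n₁ e (t + 1)
        then t + 1 else secretAt n₁ e t) ∧
      honestAt n₁ e (t + 1) = (if heightOf n₁ e (t + 1) + 1 = heightOf n₁ e (secretAt n₁ e t)
        then secretAt n₁ e t else t + 1) := by
  have h1 := secretAt_le n₁ e t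
  have h3 := state_size n₁ e t
  have h4 := target_le n₁ e t
  rw [heightOf_succ, parentOf_succ]
  unfold secretAt honestAt publishedAt at *
  rw [he] at h4 ⊢
  rw [state, he, ← state_height_eq h4]
  simp only [State.step, State.target, state_height_eq h1, h3]
  simp
  congr

theorem agreed_zero (n₁ : ℕ) (e : ℕ → Event) : Agreed n₁ e 0 := rfl

/-- An attacker block is put on top of the secret tip, and an honest block that is higher replaces
this tip. -/
theorem heightOf_le_secretAt (n₁ : ℕ) (e : ℕ → Event) (t : ℕ) :
    ∀ b ≤ t, heightOf n₁ e b ≤ heightOf n₁ e (secretAt n₁ e t) := by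
  induction t with
  | zero =>
    intro b hb
    obtain rfl : b = 0 := by omega
    exact le_rfl
  | succ t ih =>
    have hn := heightOf_succ n₁ e t
    intro b hb
    rcases he : e t with ⟨_ | _, c⟩
    · obtain ⟨h1, h2, -, -⟩ := step_selfish (n₁ := n₁) he
      rw [h2]
      rw [h1] at hn
      rcases Nat.lt_or_ge t b with h | h
      · obtain rfl : b = t + 1 := by omega
        exact le_rfl
      · have := ih b h
        omega
    · obtain ⟨-, h2, -⟩ := step_honest (n₁ := n₁) he
      rw [h2]
      rcases Nat.lt_or_ge t b with h | h
      · obtain rfl : b = t + 1 := by omega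
        split_ifs <;> omega
      · have := ih b h
        split_ifs <;> omega

theorem heightOf_publishedAt (n₁ : ℕ) (e : ℕ → Event) (t : ℕ) :
    heightOf n₁ e (publishedAt n₁ e t) = heightOf n₁ e (honestAt n₁ e t) := by
  have := heightOf_le_secretAt n₁ e t _ (honestAt_le n₁ e t)
  rw [publishedAt_eq, heightOf_iterate]
  omega

theorem parentOf_succ_cases (n₁ : ℕ) (e : ℕ → Event) (t : ℕ) :
    parentOf n₁ e (t + 1) = secretAt n₁ e t ∨ parentOf n₁ e (t + 1) = honestAt n₁ e t ∨
      parentOf n₁ e (t + 1) = publishedAt n₁ e t := by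
  rcases he : e t with ⟨_ | _, _ | _⟩
  · exact Or.inl (step_selfish he).1
  · exact Or.inl (step_selfish he).1
  · exact Or.inr (Or.inl (by simpa using (step_honest (n₁ := n₁) he).1))
  · exact Or.inr (Or.inr (by simpa using (step_honest (n₁ := n₁) he).1))

theorem tips_succ_cases (n₁ : ℕ) (e : ℕ → Event) (t : ℕ) :
    (secretAt n₁ e (t + 1) = t + 1 ∨ secretAt n₁ e (t + 1) = secretAt n₁ e t) ∧
      (honestAt n₁ e (t + 1) = t + 1 ∨ honestAt n₁ e (t + 1) = secretAt n₁ e t ∨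
        honestAt n₁ e (t + 1) = honestAt n₁ e t) := by
  rcases he : e t with ⟨_ | _, c⟩
  · obtain ⟨-, h2, h3, h4⟩ := step_selfish (n₁ := n₁) he
    refine ⟨Or.inl h2, ?_⟩
    by_cases h : honestAt n₁ e t ≠ secretAt n₁ e t ∧
        heightOf n₁ e (secretAt n₁ e t) = heightOf n₁ e (honestAt n₁ e t)
    · exact Or.inl (h3 h.1 h.2)
    · exact Or.inr (Or.inr (h4 h))
  · obtain ⟨-, h2, h3⟩ := step_honest (n₁ := n₁) he
    rw [h2, h3]
    constructor <;> split_ifs <;> simp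

/-! ### The official chain, and which official block is the nephew of an uncle -/

/-- From an agreement on, all tips are descendants of the agreed tip, and their chains have no
other old blocks than the ancestors of that tip. -/
theorem Agreed.descend {τ t : ℕ} (h : Agreed n₁ e τ) (hτ : τ ≤ t) :
    ∀ x, x = secretAt n₁ e t ∨ x = honestAt n₁ e t →
      Anc n₁ e (secretAt n₁ e τ) x ∧
        ∀ b ≤ τ, Anc n₁ e b x → Anc n₁ e b (secretAt n₁ e τ) := by
  induction t, hτ using Nat.le_induction with
  | base =>
    rintro x (rfl | rfl)
    · exact ⟨Anc.refl _ _ _, fun b _ hb => hb⟩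
    · rw [h]
      exact ⟨Anc.refl _ _ _, fun b _ hb => hb⟩
  | succ t hτ ih =>
    have hs := ih _ (Or.inl rfl)
    have hh := ih _ (Or.inr rfl)
    -- The published tip is on the chain of the secret tip, at the height of the honest tip, hence
    -- not below the agreed tip.
    have hp : Anc n₁ e (secretAt n₁ e τ) (publishedAt n₁ e t) ∧
        ∀ b ≤ τ, Anc n₁ e b (publishedAt n₁ e t) → Anc n₁ e b (secretAt n₁ e τ) :=
      ⟨hs.1.of_heightOf_le (anc_publishedAt n₁ e t)
        (by rw [heightOf_publishedAt]; exact hh.1.heightOf_le),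
        fun b hb hbp => hs.2 b hb (hbp.trans (anc_publishedAt n₁ e t))⟩
    have hnew : Anc n₁ e (secretAt n₁ e τ) (t + 1) ∧
        ∀ b ≤ τ, Anc n₁ e b (t + 1) → Anc n₁ e b (secretAt n₁ e τ) := by
      have hP : Anc n₁ e (secretAt n₁ e τ) (parentOf n₁ e (t + 1)) ∧
          ∀ b ≤ τ, Anc n₁ e b (parentOf n₁ e (t + 1)) → Anc n₁ e b (secretAt n₁ e τ) := by
        rcases parentOf_succ_cases n₁ e t with h | h | h <;> rw [h] <;> assumption
      refine ⟨hP.1.trans (anc_parentOf _ _ _), fun b hb hbt => ?_⟩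
      rcases anc_iff.1 hbt with rfl | h'
      · omega
      · exact hP.2 b hb h'
    obtain ⟨c1, c2⟩ := tips_succ_cases n₁ e t
    rintro x (rfl | rfl)
    · rcases c1 with h | h <;> rw [h] <;> assumption
    · rcases c2 with h | h | h <;> rw [h] <;> assumption

theorem isOfficial_iff_exists {b : ℕ} :
    IsOfficial n₁ e b ↔ ∃ t, Agreed n₁ e t ∧ Anc n₁ e b (secretAt n₁ e t) := by
  unfold IsOfficial
  refine exists_congr fun t => and_congr Iff.rfl ?_
  exact isAncestor_iff (secretAt_le n₁ e t) b

/-- Later agreed chains contain this agreed tip and add only younger blocks to its chain, so one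
agreement settles the status of all blocks found so far. -/
theorem isOfficial_iff {b t : ℕ} (h : Agreed n₁ e t) (hb : b ≤ t) :
    IsOfficial n₁ e b ↔ Anc n₁ e b (secretAt n₁ e t) := by
  rw [isOfficial_iff_exists]
  refine ⟨?_, fun h' => ⟨t, h, h'⟩⟩
  rintro ⟨t', ht', hb'⟩
  rcases le_total t t' with hle | hle
  · exact (h.descend hle _ (Or.inl rfl)).2 b hb hb'
  · exact hb'.trans (ht'.descend hle _ (Or.inl rfl)).1

theorem IsOfficial.exists_common {a b : ℕ} (ha : IsOfficial n₁ e a) (hb : IsOfficial n₁ e b) :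
    ∃ c, IsOfficial n₁ e c ∧ Anc n₁ e a c ∧ Anc n₁ e b c := by
  rw [isOfficial_iff_exists] at ha hb
  obtain ⟨t, ht, ha⟩ := ha
  obtain ⟨t', ht', hb⟩ := hb
  rcases le_total t t' with hle | hle
  · exact ⟨_, isOfficial_iff_exists.2 ⟨t', ht', Anc.refl _ _ _⟩,
      ha.trans (ht.descend hle _ (Or.inl rfl)).1, hb⟩
  · exact ⟨_, isOfficial_iff_exists.2 ⟨t, ht, Anc.refl _ _ _⟩, ha,
      hb.trans (ht'.descend hle _ (Or.inl rfl)).1⟩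

theorem IsOfficial.of_anc {a b : ℕ} (hb : IsOfficial n₁ e b) (h : Anc n₁ e a b) :
    IsOfficial n₁ e a := by
  rw [isOfficial_iff_exists] at hb ⊢
  obtain ⟨t, ht, hb⟩ := hb
  exact ⟨t, ht, h.trans hb⟩

theorem IsOfficial.anc_of_le {a b : ℕ} (ha : IsOfficial n₁ e a) (hb : IsOfficial n₁ e b)
    (h : a ≤ b) : Anc n₁ e a b := by
  obtain ⟨c, -, hac, hbc⟩ := ha.exists_common hb
  exact hac.of_le hbc h

theorem IsOfficial.anc_of_heightOf_le {a b : ℕ} (ha : IsOfficial n₁ e a)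
    (hb : IsOfficial n₁ e b) (h : heightOf n₁ e a ≤ heightOf n₁ e b) : Anc n₁ e a b := by
  obtain ⟨c, -, hac, hbc⟩ := ha.exists_common hb
  exact hac.of_heightOf_le hbc h

/-- The nephew of an uncle is the first official block which is younger and higher, if its distance
is at most `n₁`. -/
theorem mem_refs_iff_of_isUncle {N u : ℕ} (hu : IsUncle n₁ e u) (hN1 : 1 ≤ N)
    (hN : IsOfficial n₁ e N) :
    u ∈ (blockOf n₁ e N).refs ↔ u < N ∧ heightOf n₁ e u < heightOf n₁ e N ∧
      heightOf n₁ e N ≤ heightOf n₁ e u + n₁ ∧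
      ∀ a, IsOfficial n₁ e a → a < N → u < a → heightOf n₁ e a ≤ heightOf n₁ e u := by
  have key : ∀ N, 1 ≤ N → IsOfficial n₁ e N → u < N → heightOf n₁ e u < heightOf n₁ e N →
      heightOf n₁ e N ≤ heightOf n₁ e u + n₁ →
      (∀ a, IsOfficial n₁ e a → a < N → u < a → heightOf n₁ e a ≤ heightOf n₁ e u) →
      u ∈ (blockOf n₁ e N).refs := by
    intro N hN1 hN h1 h2 h3 h4
    have hP : IsOfficial n₁ e (parentOf n₁ e N) := hN.of_anc (anc_parentOf _ _ _)
    have hhN := heightOf_eq (n₁ := n₁) (e := e) hN1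
    have hhu := heightOf_eq (n₁ := n₁) (e := e) hu.1
    rw [mem_refs_iff hN1]
    refine ⟨h1, fun h => hu.2.1 (hP.of_anc h), ?_, h2, h3, ?_⟩
    -- Official blocks form one chain ordered by height, so comparing heights suffices to put the
    -- parent of `u` on the chain of `N`.
    · refine IsOfficial.anc_of_heightOf_le hu.2.2 hP ?_
      omega
    · intro a ha hmem
      rcases Nat.eq_zero_or_pos a with rfl | ha1
      · simp [blockOf_zero] at hmem
      · rw [mem_refs_iff ha1] at hmem
        have h5 := h4 a (hP.of_anc ha) (ha.le.trans_lt (parentOf_lt hN1)) hmem.1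
        have h6 := hmem.2.2.2.1
        omega
  refine ⟨fun h => ?_, fun ⟨h1, h2, h3, h4⟩ => key N hN1 hN h1 h2 h3 h4⟩
  have h' := (mem_refs_iff hN1).1 h
  refine ⟨h'.1, h'.2.2.2.1, h'.2.2.2.2.1, ?_⟩
  -- Otherwise the first official block that is younger and higher than `u` would have signaled it,
  -- and `N` could not do so again.
  by_contra! hcon
  classical
  have hex : ∃ a, IsOfficial n₁ e a ∧ a < N ∧ u < a ∧ heightOf n₁ e u < heightOf n₁ e a := hcon
  set a := Nat.find hex with ha
  obtain ⟨a1, a2, a3, a4⟩ := Nat.find_spec hex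
  rw [← ha] at a1 a2 a3 a4
  have haN := a1.anc_of_le hN a2.le
  have hmem : u ∈ (blockOf n₁ e a).refs := by
    refine key a (by omega) a1 a3 a4 (haN.heightOf_le.trans h'.2.2.2.2.1) ?_
    intro b hb hba hub
    by_contra! hlt
    exact Nat.find_min hex hba ⟨hb, hba.trans a2, hub, hlt⟩
  refine h'.2.2.2.2.2 a ?_ hmem
  rcases anc_iff.1 haN with h6 | h6
  · omega
  · exact h6

end SelfishMining

/-! ### One attack cycle: its phases, its outcome, and the uncles it produces -/

namespace SelfishMining

/-- The phase of an attack cycle: no block yet; one secret block; two public branches of one block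
each; or a fork which leads by `i + 2` blocks, where `fresh` says that the honest miners have found
no block in the cycle, and `c` is the number of uncles which will be close enough
to the next block on top of the fork to be signaled by it. -/
inductive Phase : Type
  | agree
  | lead
  | tie
  | fork (i : ℕ) (fresh : Bool) (c : ℕ)

/-- What matters of a finished attack cycle: the number of uncles left to the next cycle, the number
of uncles with an honest nephew in the cycle, and whether the first official block is honest. -/
structure Outcome : Type where
  pending : ℕ
  own : ℕ
  honestFirst : Bool

/-- The weight of an honest block on a fork of the attacker which leads by `i + 2` blocks: one
if it is an uncle which the next official block can signal. -/
def uncleWeight (n₁ i : ℕ) (fresh coin : Bool) : ℕ :=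
  if (fresh = true ∨ coin = true) ∧ i + 2 ≤ n₁ then 1 else 0

/-- The phase after an event, or the outcome of the cycle if the event ends it. -/
def Phase.next (n₁ : ℕ) : Phase → Event → Phase ⊕ Outcome
  | agree, (Miner.selfish, _) => Sum.inl lead
  | agree, (Miner.honest, _) => Sum.inr ⟨0, 0, true⟩
  | lead, (Miner.selfish, _) => Sum.inl (fork 0 true 0)
  | lead, (Miner.honest, _) => Sum.inl tie
  | tie, (Miner.selfish, _) => Sum.inr ⟨0, 0, false⟩
  | tie, (Miner.honest, coin) => Sum.inr ⟨0, 1, !coin⟩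
  | fork i fresh _, (Miner.selfish, _) => Sum.inl (fork (i + 1) fresh 0)
  | fork 0 fresh c, (Miner.honest, coin) => Sum.inr ⟨c + uncleWeight n₁ 0 fresh coin, 0, false⟩
  | fork (i + 1) fresh c, (Miner.honest, coin) =>
    Sum.inl (fork i false (c + uncleWeight n₁ (i + 1) fresh coin))

variable {n₁ : ℕ} {e : ℕ → Event}

/-- The orphans found after event `τ` and until event `t` whose parent is on the chain of the fork
of the attacker, and which will be signaled by the next block on top of the fork. -/
def pendingUncles (n₁ : ℕ) (e : ℕ → Event) (τ t : ℕ) : Set ℕ :=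
  {u | τ < u ∧ u ≤ t ∧ ¬ Anc n₁ e u (secretAt n₁ e t) ∧
    Anc n₁ e (parentOf n₁ e u) (secretAt n₁ e t) ∧
    (∀ a, u < a → a ≤ t → Anc n₁ e a (secretAt n₁ e t) → heightOf n₁ e a ≤ heightOf n₁ e u) ∧
    heightOf n₁ e (secretAt n₁ e t) + 1 ≤ heightOf n₁ e u + n₁}

/-- The uncles found after event `τ` and until event `t` which have an honest nephew found until
event `t`, when the fork of the attacker becomes official after event `t`. -/
def ownUncles (n₁ : ℕ) (e : ℕ → Event) (τ t : ℕ) : Set ℕ :=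
  {u | τ < u ∧ u ≤ t ∧ ¬ Anc n₁ e u (secretAt n₁ e t) ∧
    Anc n₁ e (parentOf n₁ e u) (secretAt n₁ e t) ∧
    ∃ N, u < N ∧ N ≤ t ∧ Anc n₁ e N (secretAt n₁ e t) ∧ (blockOf n₁ e N).miner = Miner.honest ∧
      heightOf n₁ e u < heightOf n₁ e N ∧ heightOf n₁ e N ≤ heightOf n₁ e u + n₁ ∧
      ∀ a, Anc n₁ e a (secretAt n₁ e t) → a < N → u < a → heightOf n₁ e a ≤ heightOf n₁ e u}

/-- What a phase says about the blocks, in a cycle that started after event `τ`. -/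
def PhaseSpec (n₁ : ℕ) (e : ℕ → Event) (τ t : ℕ) : Phase → Prop
  | Phase.agree => t = τ
  | Phase.lead => t = τ + 1 ∧ secretAt n₁ e t = τ + 1 ∧ honestAt n₁ e t = secretAt n₁ e τ ∧
      parentOf n₁ e (τ + 1) = secretAt n₁ e τ ∧ (blockOf n₁ e (τ + 1)).miner = Miner.selfish
  | Phase.tie => t = τ + 2 ∧ secretAt n₁ e t = τ + 1 ∧ honestAt n₁ e t = τ + 2 ∧
      parentOf n₁ e (τ + 1) = secretAt n₁ e τ ∧ parentOf n₁ e (τ + 2) = secretAt n₁ e τ ∧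
      (blockOf n₁ e (τ + 1)).miner = Miner.selfish ∧
      (blockOf n₁ e (τ + 2)).miner = Miner.honest
  | Phase.fork i fresh c => τ < t ∧
      heightOf n₁ e (secretAt n₁ e t) = heightOf n₁ e (honestAt n₁ e t) + i + 2 ∧
      (∀ b, τ < b → b ≤ t →
        (Anc n₁ e b (secretAt n₁ e t) ↔ (blockOf n₁ e b).miner = Miner.selfish)) ∧
      (Anc n₁ e (honestAt n₁ e t) (secretAt n₁ e t) ↔ fresh = true) ∧
      (pendingUncles n₁ e τ t).ncard = c

/-- What the outcome says about the blocks of a cycle, found after event `τ` and until `t`. -/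
structure OutcomeSpec (n₁ : ℕ) (e : ℕ → Event) (τ t : ℕ) (o : Outcome) : Prop where
  lt : τ < t
  pending : (pendingUncles n₁ e τ t).ncard = o.pending
  own : (ownUncles n₁ e τ t).ncard = o.own
  first : ∃ f, τ < f ∧ f ≤ t ∧ Anc n₁ e f (secretAt n₁ e t) ∧
    parentOf n₁ e f = secretAt n₁ e τ ∧
    ((blockOf n₁ e f).miner = Miner.honest ↔ o.honestFirst = true)

theorem pendingUncles_finite (n₁ : ℕ) (e : ℕ → Event) (τ t : ℕ) :
    (pendingUncles n₁ e τ t).Finite :=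
  (Set.finite_Iic t).subset fun _ hu => hu.2.1

theorem ownUncles_finite (n₁ : ℕ) (e : ℕ → Event) (τ t : ℕ) :
    (ownUncles n₁ e τ t).Finite :=
  (Set.finite_Iic t).subset fun _ hu => hu.2.1

/-- The oldest block found after `τ` on the final chain. Its parent is an old block of that chain,
hence the agreed tip or below it, and the agreed tip is itself a proper ancestor. It is the only
possible later nephew for the uncles of the preceding cycle. -/
theorem exists_first {τ t : ℕ} (hτ : Agreed n₁ e τ) (hlt : τ < t) (h : τ < secretAt n₁ e t) :
    ∃ f, τ < f ∧ f ≤ t ∧ Anc n₁ e f (secretAt n₁ e t) ∧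
      parentOf n₁ e f = secretAt n₁ e τ := by
  classical
  have hd := hτ.descend hlt.le _ (Or.inl rfl)
  have hex : ∃ f, τ < f ∧ Anc n₁ e f (secretAt n₁ e t) := ⟨_, h, Anc.refl _ _ _⟩
  obtain ⟨h1, h2⟩ := Nat.find_spec hex
  set f := Nat.find hex with hf
  refine ⟨f, h1, h2.le.trans (secretAt_le _ _ _), h2, ?_⟩
  have hpf : Anc n₁ e (parentOf n₁ e f) (secretAt n₁ e t) := (anc_parentOf _ _ _).trans h2
  have hle : parentOf n₁ e f ≤ τ := by
    by_contra! hcon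
    exact Nat.find_min hex (parentOf_lt (by omega)) ⟨hcon, hpf⟩
  have h3 := hd.2 _ hle hpf
  have h4 : Anc n₁ e (secretAt n₁ e τ) f := hd.1.of_le h2 ((secretAt_le _ _ _).trans h1.le)
  rcases anc_iff.1 h4 with h5 | h5
  · have := secretAt_le n₁ e τ
    omega
  · exact le_antisymm h3.le h5.le

/-- The pending count drops to `0` because the new tip is higher than every earlier block: an orphan
is signaled by it or is already too far away. -/
theorem phaseSpec_fork_selfish {τ t i c : ℕ} {fresh coin : Bool}
    (h : PhaseSpec n₁ e τ t (Phase.fork i fresh c)) (he : e t = (Miner.selfish, coin)) :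
    PhaseSpec n₁ e τ (t + 1) (Phase.fork (i + 1) fresh 0) ∧ ¬ Agreed n₁ e (t + 1) := by
  obtain ⟨h1, h2, h3, h4, -⟩ := h
  obtain ⟨s1, s2, -, s3⟩ := step_selfish (n₁ := n₁) he
  replace s3 := s3 (fun h => by omega)
  have hm : (blockOf n₁ e (t + 1)).miner = Miner.selfish := by rw [minerOf_succ, he]
  have hh := heightOf_succ n₁ e t
  have hsl := secretAt_le n₁ e t
  have hhl := honestAt_le n₁ e t
  have hanc : ∀ b, Anc n₁ e b (t + 1) ↔ b = t + 1 ∨ Anc n₁ e b (secretAt n₁ e t) := by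
    intro b
    rw [anc_iff, s1]
  rw [s1] at hh
  refine ⟨⟨by omega, ?_, ?_, ?_, ?_⟩, ?_⟩
  · rw [s2, s3]
    omega
  · intro b hb hbt
    rw [s2, hanc]
    rcases Nat.lt_or_ge t b with hlt | hle
    · obtain rfl : b = t + 1 := by omega
      simp [hm]
    · rw [h3 b hb hle]
      exact or_iff_right (by omega)
  · rw [s2, s3, hanc, h4]
    exact or_iff_right (by omega)
  · rw [Set.ncard_eq_zero (pendingUncles_finite _ _ _ _), Set.eq_empty_iff_forall_notMem]
    rintro u ⟨hu1, hu2, hu3, -, hu5, -⟩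
    rw [s2] at hu3 hu5
    rcases Nat.lt_or_ge t u with hlt | hle
    · obtain rfl : u = t + 1 := by omega
      exact hu3 (Anc.refl _ _ _)
    · have := hu5 (t + 1) (by omega) le_rfl (Anc.refl _ _ _)
      have := heightOf_le_secretAt n₁ e t u hle
      omega
  · rw [Agreed, s2, s3]
    omega

/-- The secret tip does not move, so the status of older orphans is unchanged and only the new block
may be added. It lies `i + 1` below the secret tip, hence at distance `i + 2` from the next block of
the fork. -/
theorem pendingUncles_fork_honest {τ t i c : ℕ} {fresh coin : Bool}
    (h : PhaseSpec n₁ e τ t (Phase.fork i fresh c)) (he : e t = (Miner.honest, coin)) :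
    secretAt n₁ e (t + 1) = secretAt n₁ e t ∧
      heightOf n₁ e (t + 1) = heightOf n₁ e (honestAt n₁ e t) + 1 ∧
      (∀ b, τ < b → b ≤ t + 1 →
        (Anc n₁ e b (secretAt n₁ e t) ↔ (blockOf n₁ e b).miner = Miner.selfish)) ∧
      (pendingUncles n₁ e τ (t + 1)).ncard = c + uncleWeight n₁ i fresh coin := by
  obtain ⟨h1, h2, h3, h4, h5⟩ := h
  obtain ⟨s1, s2, -⟩ := step_honest (n₁ := n₁) he
  have hm : (blockOf n₁ e (t + 1)).miner = Miner.honest := by rw [minerOf_succ, he]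
  have hsl := secretAt_le n₁ e t
  have hh : heightOf n₁ e (t + 1) = heightOf n₁ e (honestAt n₁ e t) + 1 := by
    rw [heightOf_succ, s1]
    split_ifs
    · rw [heightOf_publishedAt]
    · rfl
  rw [if_neg (by omega)] at s2
  have hnew : ¬ Anc n₁ e (t + 1) (secretAt n₁ e t) := fun h => by
    have := h.le
    omega
  -- With the coin `true` the parent is the published tip, which is on the fork; otherwise it is the
  -- honest tip, on the fork exactly while `fresh` holds.
  have hpar : Anc n₁ e (parentOf n₁ e (t + 1)) (secretAt n₁ e t) ↔
      fresh = true ∨ coin = true := by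
    rw [s1]
    split_ifs with hc
    · simp [hc, anc_publishedAt]
    · simp [hc, h4]
  refine ⟨s2, hh, ?_, ?_⟩
  · intro b hb hbt
    rcases Nat.lt_or_ge t b with hlt | hle
    · obtain rfl : b = t + 1 := by omega
      simp [hm, hnew]
    · exact h3 b hb hle
  · have hold : ∀ u, u ≤ t → (u ∈ pendingUncles n₁ e τ (t + 1) ↔ u ∈ pendingUncles n₁ e τ t) := by
      intro u hu
      simp only [pendingUncles, Set.mem_ofPred_eq, s2]
      refine and_congr_right fun _ => and_congr (by omega) <| and_congr_right fun _ =>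
        and_congr_right fun _ => and_congr_left fun _ => forall_congr' fun a =>
        forall_congr' fun _ => ?_
      constructor
      · exact fun h ha => h (by omega)
      · intro h ha hanc
        refine h ?_ hanc
        have := hanc.le
        omega
    have hlast : t + 1 ∈ pendingUncles n₁ e τ (t + 1) ↔
        (fresh = true ∨ coin = true) ∧ i + 2 ≤ n₁ := by
      simp only [pendingUncles, Set.mem_ofPred_eq, s2, hpar, hnew, hh, h2]
      constructor
      · rintro ⟨-, -, -, h6, -, h7⟩
        exact ⟨h6, by omega⟩
      · rintro ⟨h6, h7⟩
        exact ⟨by omega, le_rfl, not_false, h6, fun a h8 h9 => by omega, by omega⟩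
    have hle : ∀ u, u ∈ pendingUncles n₁ e τ (t + 1) → u ≤ t + 1 := fun u hu => hu.2.1
    have hnot : t + 1 ∉ pendingUncles n₁ e τ t := fun hu => by
      have := hu.2.1
      omega
    rw [uncleWeight]
    split_ifs with hc
    · rw [← h5, ← Set.ncard_insert_of_notMem hnot (pendingUncles_finite _ _ _ _)]
      congr 1
      ext u
      rw [Set.mem_insert_iff]
      constructor
      · intro hu
        rcases Nat.lt_or_ge t u with hlt | hle'
        · have := hle u hu
          left
          omega
        · exact Or.inr ((hold u hle').1 hu)
      · rintro (rfl | hu)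
        · exact hlast.2 hc
        · exact (hold u hu.2.1).2 hu
    · rw [← h5, Nat.add_zero]
      congr 1
      ext u
      constructor
      · intro hu
        rcases Nat.lt_or_ge t u with hlt | hle'
        · obtain rfl : u = t + 1 := by
            have := hle u hu
            omega
          exact absurd (hlast.1 hu) hc
        · exact (hold u hle').1 hu
      · exact fun hu => (hold u hu.2.1).2 hu

theorem phaseSpec_fork_honest {τ t i c : ℕ} {fresh coin : Bool}
    (h : PhaseSpec n₁ e τ t (Phase.fork (i + 1) fresh c)) (he : e t = (Miner.honest, coin)) :
    PhaseSpec n₁ e τ (t + 1) (Phase.fork i false (c + uncleWeight n₁ (i + 1) fresh coin)) ∧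
      ¬ Agreed n₁ e (t + 1) := by
  obtain ⟨p1, p2, p3, p4⟩ := pendingUncles_fork_honest h he
  obtain ⟨h1, h2, h3, h4, -⟩ := h
  obtain ⟨s1, -, s3⟩ := step_honest (n₁ := n₁) he
  have hsl := secretAt_le n₁ e t
  rw [if_neg (by omega)] at s3
  refine ⟨⟨by omega, ?_, ?_, ?_, p4⟩, ?_⟩
  · rw [p1, s3]
    omega
  · rw [p1]
    exact p3
  · rw [p1, s3]
    simp only [Bool.false_eq_true, iff_false]
    intro h
    have := h.le
    omega
  · rw [Agreed, p1, s3]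
    omega

/-- The official blocks of such a cycle are all the attacker's, so no uncle has an honest nephew
inside it and the first official block is not honest. -/
theorem outcomeSpec_fork {τ t c : ℕ} {fresh coin : Bool} (hτ : Agreed n₁ e τ)
    (h : PhaseSpec n₁ e τ t (Phase.fork 0 fresh c)) (he : e t = (Miner.honest, coin)) :
    OutcomeSpec n₁ e τ (t + 1) ⟨c + uncleWeight n₁ 0 fresh coin, 0, false⟩ ∧
      Agreed n₁ e (t + 1) := by
  obtain ⟨p1, p2, p3, p4⟩ := pendingUncles_fork_honest h he
  obtain ⟨h1, h2, h3, h4, -⟩ := h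
  obtain ⟨s1, -, s3⟩ := step_honest (n₁ := n₁) he
  have hsl := secretAt_le n₁ e t
  rw [if_pos (by omega)] at s3
  rw [← p1] at p3
  refine ⟨⟨by omega, p4, ?_, ?_⟩, ?_⟩
  · rw [Set.ncard_eq_zero (ownUncles_finite _ _ _ _), Set.eq_empty_iff_forall_notMem]
    rintro u ⟨hu1, -, -, -, N, hN1, hN2, hN3, hN4, -⟩
    have := (p3 N (by omega) hN2).1 hN3
    rw [this] at hN4
    cases hN4
  -- A tip found by time `τ` would be no higher than the agreed tip, hence no higher than the honest
  -- tip, against the lead.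
  · have hlt : τ < secretAt n₁ e (t + 1) := by
      by_contra! hcon
      have hd := hτ.descend h1.le
      have e1 := heightOf_le_secretAt n₁ e τ _ hcon
      have e2 := (hd _ (Or.inr rfl)).1.heightOf_le
      rw [p1] at e1
      omega
    obtain ⟨f, f1, f2, f3, f4⟩ := exists_first hτ (by omega) hlt
    refine ⟨f, f1, f2, f3, f4, ?_⟩
    rw [(p3 f f1 f2).1 f3]
    simp
  · rw [Agreed, p1, s3]

theorem phaseSpec_lead {τ : ℕ} {coin : Bool} (hτ : Agreed n₁ e τ)
    (he : e τ = (Miner.selfish, coin)) :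
    PhaseSpec n₁ e τ (τ + 1) Phase.lead ∧ ¬ Agreed n₁ e (τ + 1) := by
  obtain ⟨s1, s2, -, s3⟩ := step_selfish (n₁ := n₁) he
  replace s3 := s3 (fun h => h.1 hτ)
  have := honestAt_le n₁ e τ
  exact ⟨⟨rfl, s2, s3.trans hτ, s1, by rw [minerOf_succ, he]⟩, by rw [Agreed, s2, s3]; omega⟩

theorem Agreed.step_honest {τ : ℕ} {coin : Bool} (hτ : Agreed n₁ e τ)
    (he : e τ = (Miner.honest, coin)) :
    parentOf n₁ e (τ + 1) = secretAt n₁ e τ ∧ secretAt n₁ e (τ + 1) = τ + 1 ∧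
      honestAt n₁ e (τ + 1) = τ + 1 := by
  obtain ⟨s1, s2, s3⟩ := SelfishMining.step_honest (n₁ := n₁) he
  -- Both possible parents coincide at an agreement, so the coin has no effect.
  have hp : publishedAt n₁ e τ = secretAt n₁ e τ :=
    (anc_publishedAt n₁ e τ).eq_of_heightOf_le (by rw [heightOf_publishedAt, hτ])
  rw [hp, hτ, ite_self] at s1
  have hh := heightOf_succ n₁ e τ
  rw [s1] at hh
  rw [if_pos (by omega)] at s2
  rw [if_neg (by omega)] at s3
  exact ⟨s1, s2, s3⟩

theorem outcomeSpec_agree {τ : ℕ} {coin : Bool} (hτ : Agreed n₁ e τ)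
    (he : e τ = (Miner.honest, coin)) :
    OutcomeSpec n₁ e τ (τ + 1) ⟨0, 0, true⟩ ∧ Agreed n₁ e (τ + 1) := by
  obtain ⟨s1, s2, s3⟩ := hτ.step_honest he
  refine ⟨⟨by omega, ?_, ?_, ?_⟩, by rw [Agreed, s2, s3]⟩
  · rw [Set.ncard_eq_zero (pendingUncles_finite _ _ _ _), Set.eq_empty_iff_forall_notMem]
    rintro u ⟨hu1, hu2, hu3, -⟩
    obtain rfl : u = τ + 1 := by omega
    rw [s2] at hu3
    exact hu3 (Anc.refl _ _ _)
  · rw [Set.ncard_eq_zero (ownUncles_finite _ _ _ _), Set.eq_empty_iff_forall_notMem]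
    rintro u ⟨hu1, hu2, hu3, -⟩
    obtain rfl : u = τ + 1 := by omega
    rw [s2] at hu3
    exact hu3 (Anc.refl _ _ _)
  · refine ⟨τ + 1, by omega, le_rfl, by rw [s2]; exact Anc.refl _ _ _, s1, ?_⟩
    simp [minerOf_succ, he]

theorem phaseSpec_tie {τ t : ℕ} {coin : Bool} (h : PhaseSpec n₁ e τ t Phase.lead)
    (hτ : Agreed n₁ e τ) (he : e t = (Miner.honest, coin)) :
    PhaseSpec n₁ e τ (t + 1) Phase.tie ∧ ¬ Agreed n₁ e (t + 1) := by
  obtain ⟨rfl, h2, h3, h4, h5⟩ := h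
  obtain ⟨s1, s2, s3⟩ := step_honest (n₁ := n₁) he
  have hh1 := heightOf_succ n₁ e τ
  have hh2 := heightOf_succ n₁ e (τ + 1)
  -- Nothing of the fork is public yet: again both possible parents are the agreed tip.
  have hp : publishedAt n₁ e (τ + 1) = secretAt n₁ e τ := by
    have h6 := heightOf_publishedAt n₁ e (τ + 1)
    rw [h3] at h6
    have h7 : Anc n₁ e (secretAt n₁ e τ) (secretAt n₁ e (τ + 1)) :=
      (hτ.descend (Nat.le_succ τ) _ (Or.inl rfl)).1
    exact ((anc_publishedAt n₁ e (τ + 1)).of_heightOf_le h7 h6.le).eq_of_heightOf_le h6.ge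
  rw [h3, hp, ite_self] at s1
  rw [h4] at hh1
  rw [s1] at hh2
  rw [h2, if_neg (by omega)] at s2
  rw [h2, if_neg (by omega)] at s3
  exact ⟨⟨rfl, s2, s3, h4, s1, h5, by rw [minerOf_succ, he]⟩, by rw [Agreed, s2, s3]; omega⟩

theorem phaseSpec_fork_zero {τ t : ℕ} {coin : Bool} (h : PhaseSpec n₁ e τ t Phase.lead)
    (he : e t = (Miner.selfish, coin)) :
    PhaseSpec n₁ e τ (t + 1) (Phase.fork 0 true 0) ∧ ¬ Agreed n₁ e (t + 1) := by
  obtain ⟨rfl, h2, h3, h4, h5⟩ := h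
  obtain ⟨s1, s2, -, s3⟩ := step_selfish (n₁ := n₁) he
  have hm : (blockOf n₁ e (τ + 1 + 1)).miner = Miner.selfish := by rw [minerOf_succ, he]
  have hh1 := heightOf_succ n₁ e τ
  have hh2 := heightOf_succ n₁ e (τ + 1)
  have hle := secretAt_le n₁ e τ
  rw [h4] at hh1
  rw [s1, h2] at hh2
  rw [h2] at s1
  replace s3 := s3 (fun h => by rw [h2, h3] at h; omega)
  rw [h3] at s3
  have hanc : ∀ b, Anc n₁ e b (τ + 1 + 1) ↔
      b = τ + 1 + 1 ∨ b = τ + 1 ∨ Anc n₁ e b (secretAt n₁ e τ) := by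
    intro b
    rw [anc_iff, s1, anc_iff (b := τ + 1), h4]
  refine ⟨⟨by omega, ?_, ?_, ?_, ?_⟩, by rw [Agreed, s2, s3]; omega⟩
  · rw [s2, s3]
    omega
  · intro b hb hbt
    rw [s2, hanc]
    obtain rfl | rfl : b = τ + 1 ∨ b = τ + 1 + 1 := by omega
    · simp [h5]
    · simp [hm]
  · rw [s2, s3, hanc]
    simp [Anc.refl]
  · rw [Set.ncard_eq_zero (pendingUncles_finite _ _ _ _), Set.eq_empty_iff_forall_notMem]
    rintro u ⟨hu1, hu2, hu3, -⟩
    rw [s2, hanc] at hu3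
    omega

/-- The orphaned honest block `τ + 2` is overtaken by the attacker's block `τ + 3`, so it is neither
pending nor given an honest nephew. -/
theorem outcomeSpec_tie_selfish {τ t : ℕ} {coin : Bool} (h : PhaseSpec n₁ e τ t Phase.tie)
    (he : e t = (Miner.selfish, coin)) :
    OutcomeSpec n₁ e τ (t + 1) ⟨0, 0, false⟩ ∧ Agreed n₁ e (t + 1) := by
  obtain ⟨rfl, h2, h3, h4, h5, h6, h7⟩ := h
  obtain ⟨s1, s2, s3, -⟩ := step_selfish (n₁ := n₁) he
  have hm : (blockOf n₁ e (τ + 2 + 1)).miner = Miner.selfish := by rw [minerOf_succ, he]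
  have hh1 := heightOf_eq (n₁ := n₁) (e := e) (b := τ + 1) (by omega)
  have hh2 := heightOf_eq (n₁ := n₁) (e := e) (b := τ + 2) (by omega)
  have hh3 := heightOf_eq (n₁ := n₁) (e := e) (b := τ + 2 + 1) (by omega)
  have hle := secretAt_le n₁ e τ
  rw [h2] at s1
  rw [h4] at hh1
  rw [h5] at hh2
  rw [s1] at hh3
  rw [h2, h3] at s3
  replace s3 := s3 (by omega) (by omega)
  have hanc : ∀ b, Anc n₁ e b (τ + 2 + 1) ↔
      b = τ + 2 + 1 ∨ b = τ + 1 ∨ Anc n₁ e b (secretAt n₁ e τ) := by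
    intro b
    rw [anc_iff, s1, anc_iff (b := τ + 1), h4]
  refine ⟨⟨by omega, ?_, ?_, ?_⟩, by rw [Agreed, s2, s3]⟩
  · rw [Set.ncard_eq_zero (pendingUncles_finite _ _ _ _), Set.eq_empty_iff_forall_notMem]
    rintro u ⟨hu1, hu2, hu3, -, hu5, -⟩
    rw [s2] at hu3 hu5
    rw [hanc] at hu3
    obtain rfl : u = τ + 2 := by omega
    have := hu5 (τ + 2 + 1) (by omega) le_rfl (Anc.refl _ _ _)
    omega
  · rw [Set.ncard_eq_zero (ownUncles_finite _ _ _ _), Set.eq_empty_iff_forall_notMem]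
    rintro u ⟨hu1, hu2, hu3, -, N, hN1, hN2, hN3, hN4, -⟩
    rw [s2, hanc] at hu3 hN3
    have : ¬ Anc n₁ e N (secretAt n₁ e τ) := fun h => by
      have := h.le
      omega
    obtain rfl : N = τ + 2 + 1 := by omega
    rw [hm] at hN4
    cases hN4
  · refine ⟨τ + 1, by omega, by omega, by rw [s2, hanc]; simp, h4, ?_⟩
    simp [h6]

/-- Whichever of the two competing blocks loses, it is an uncle at distance `1` from the closing
honest block, within range since `1 ≤ n₁`. The coin only decides who mined the first official block.
-/
theorem outcomeSpec_tie_honest {τ t : ℕ} {coin : Bool} (hn₁ : 1 ≤ n₁)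
    (h : PhaseSpec n₁ e τ t Phase.tie) (he : e t = (Miner.honest, coin)) :
    OutcomeSpec n₁ e τ (t + 1) ⟨0, 1, !coin⟩ ∧ Agreed n₁ e (t + 1) := by
  obtain ⟨rfl, h2, h3, h4, h5, h6, h7⟩ := h
  obtain ⟨s1, s2, s3⟩ := step_honest (n₁ := n₁) he
  have hm : (blockOf n₁ e (τ + 2 + 1)).miner = Miner.honest := by rw [minerOf_succ, he]
  have hh1 := heightOf_eq (n₁ := n₁) (e := e) (b := τ + 1) (by omega)
  have hh2 := heightOf_eq (n₁ := n₁) (e := e) (b := τ + 2) (by omega)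
  have hh3 := heightOf_eq (n₁ := n₁) (e := e) (b := τ + 2 + 1) (by omega)
  have hle := secretAt_le n₁ e τ
  rw [h4] at hh1
  rw [h5] at hh2
  have hp : publishedAt n₁ e (τ + 2) = τ + 1 := by
    rw [publishedAt_eq, h2, h3]
    simp [hh1, hh2]
  rw [hp, h3] at s1
  -- the winning block and the orphaned one
  obtain ⟨w, o, hw, ho, hwo, hP, hwm⟩ : ∃ w o, (w = τ + 1 ∨ w = τ + 2) ∧ (o = τ + 1 ∨ o = τ + 2) ∧
      w ≠ o ∧ parentOf n₁ e (τ + 2 + 1) = w ∧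
      ((blockOf n₁ e w).miner = Miner.honest ↔ (!coin) = true) := by
    cases coin
    · refine ⟨τ + 2, τ + 1, by simp, by simp, by omega, by simpa using s1, ?_⟩
      simp [h7]
    · refine ⟨τ + 1, τ + 2, by simp, by simp, by omega, by simpa using s1, ?_⟩
      simp [h6]
  have hwp : parentOf n₁ e w = secretAt n₁ e τ := by rcases hw with rfl | rfl <;> assumption
  have hop : parentOf n₁ e o = secretAt n₁ e τ := by rcases ho with rfl | rfl <;> assumption
  have hwh : heightOf n₁ e w = heightOf n₁ e (secretAt n₁ e τ) + 1 := by
    rcases hw with rfl | rfl <;> assumption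
  have hoh : heightOf n₁ e o = heightOf n₁ e (secretAt n₁ e τ) + 1 := by
    rcases ho with rfl | rfl <;> assumption
  rw [hP] at hh3
  rw [h2, if_pos (by omega)] at s2
  rw [h2, if_neg (by omega)] at s3
  have hanc : ∀ b, Anc n₁ e b (τ + 2 + 1) ↔
      b = τ + 2 + 1 ∨ b = w ∨ Anc n₁ e b (secretAt n₁ e τ) := by
    intro b
    rw [anc_iff, hP, anc_iff (b := w), hwp]
  refine ⟨⟨by omega, ?_, ?_, ?_⟩, by rw [Agreed, s2, s3]⟩
  · rw [Set.ncard_eq_zero (pendingUncles_finite _ _ _ _), Set.eq_empty_iff_forall_notMem]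
    rintro u ⟨hu1, hu2, hu3, -, hu5, -⟩
    rw [s2] at hu3 hu5
    rw [hanc] at hu3
    obtain rfl : u = o := by omega
    have := hu5 (τ + 2 + 1) (by omega) le_rfl (Anc.refl _ _ _)
    omega
  · rw [Set.ncard_eq_one]
    refine ⟨o, Set.eq_singleton_iff_unique_mem.2 ⟨?_, ?_⟩⟩
    · refine ⟨by omega, by omega, ?_, ?_, τ + 2 + 1, by omega, le_rfl, ?_, hm, by omega,
        by omega, ?_⟩
      · rw [s2, hanc]
        intro h
        have : ¬ Anc n₁ e o (secretAt n₁ e τ) := fun h => by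
          have := h.le
          omega
        rcases h with h | h | h
        · omega
        · exact hwo h.symm
        · exact this h
      · rw [s2, hanc, hop]
        exact Or.inr (Or.inr (Anc.refl _ _ _))
      · rw [s2]
        exact Anc.refl _ _ _
      · intro a ha h7 h8
        rw [s2, hanc] at ha
        rcases ha with rfl | rfl | ha
        · omega
        · omega
        · have := ha.heightOf_le
          omega
    · rintro u ⟨hu1, hu2, hu3, -⟩
      rw [s2, hanc] at hu3
      omega
  · exact ⟨w, by omega, by omega, by rw [s2, hanc]; simp, hwp, hwm⟩

theorem phaseSpec_next (hn₁ : 1 ≤ n₁) {τ t : ℕ} (hτ : Agreed n₁ e τ) (ph : Phase)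
    (h : PhaseSpec n₁ e τ t ph) :
    (∀ ph', ph.next n₁ (e t) = Sum.inl ph' →
      PhaseSpec n₁ e τ (t + 1) ph' ∧ ¬ Agreed n₁ e (t + 1)) ∧
    ∀ o, ph.next n₁ (e t) = Sum.inr o → OutcomeSpec n₁ e τ (t + 1) o ∧ Agreed n₁ e (t + 1) := by
  rcases he : e t with ⟨_ | _, coin⟩
  · match ph, h with
    | .agree, h =>
      cases h
      refine ⟨?_, by simp [Phase.next]⟩
      rintro _ ⟨⟩
      exact phaseSpec_lead hτ he
    | .lead, h =>
      refine ⟨?_, by simp [Phase.next]⟩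
      rintro _ ⟨⟩
      exact phaseSpec_fork_zero h he
    | .tie, h =>
      refine ⟨by simp [Phase.next], ?_⟩
      rintro _ ⟨⟩
      exact outcomeSpec_tie_selfish h he
    | .fork i fresh c, h =>
      refine ⟨?_, by simp [Phase.next]⟩
      rintro _ ⟨⟩
      exact phaseSpec_fork_selfish h he
  · match ph, h with
    | .agree, h =>
      cases h
      refine ⟨by simp [Phase.next], ?_⟩
      rintro _ ⟨⟩
      exact outcomeSpec_agree hτ he
    | .lead, h =>
      refine ⟨?_, by simp [Phase.next]⟩
      rintro _ ⟨⟩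
      exact phaseSpec_tie h hτ he
    | .tie, h =>
      refine ⟨by simp [Phase.next], ?_⟩
      rintro _ ⟨⟩
      exact outcomeSpec_tie_honest hn₁ h he
    | .fork 0 fresh c, h =>
      refine ⟨by simp [Phase.next], ?_⟩
      rintro _ ⟨⟩
      exact outcomeSpec_fork hτ h he
    | .fork (i + 1) fresh c, h =>
      refine ⟨?_, by simp [Phase.next]⟩
      rintro _ ⟨⟩
      exact phaseSpec_fork_honest h he

end SelfishMining

/-! ### The sequence of cycles: the two counts read off a summary -/

namespace SelfishMining

variable {n₁ : ℕ} {e : ℕ → Event}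

/-- The finished cycles, the phase of the current one, the number of uncles which cycle `n` left to
cycle `n + 1`, and the number of uncles of cycle `n` with an honest nephew. -/
structure Summary : Type where
  cycle : ℕ
  phase : Phase
  pending : ℕ
  count : ℕ

def Summary.init : Summary := ⟨0, Phase.agree, 0, 0⟩

/-- The summary after the end of a cycle. -/
def Summary.finish (n : ℕ) (x : Summary) (o : Outcome) : Summary :=
  if x.cycle = n then ⟨x.cycle + 1, Phase.agree, o.pending, o.own⟩
  -- The first official block of cycle `n + 1` is the nephew of all pending uncles of cycle `n`;
  -- after that both counters are frozen.
  else if x.cycle = n + 1 ∧ o.honestFirst = true then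
    ⟨x.cycle + 1, Phase.agree, x.pending, x.count + x.pending⟩
  else ⟨x.cycle + 1, Phase.agree, x.pending, x.count⟩

def Summary.step (n₁ n : ℕ) (x : Summary) (ev : Event) : Summary :=
  match x.phase.next n₁ ev with
  | Sum.inl ph => ⟨x.cycle, ph, x.pending, x.count⟩
  | Sum.inr o => x.finish n o

/-- The summary after `t` events. -/
def summary (n₁ n : ℕ) (e : ℕ → Event) : ℕ → Summary
  | 0 => Summary.init
  | t + 1 => (summary n₁ n e t).step n₁ n (e t)

@[simp] theorem Summary.finish_cycle (n : ℕ) (x : Summary) (o : Outcome) :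
    (x.finish n o).cycle = x.cycle + 1 := by
  unfold Summary.finish
  split_ifs <;> rfl

@[simp] theorem Summary.finish_phase (n : ℕ) (x : Summary) (o : Outcome) :
    (x.finish n o).phase = Phase.agree := by
  unfold Summary.finish
  split_ifs <;> rfl

/-- Two consecutive agreements, between which cycle `k` takes place. -/
structure IsCycle (n₁ : ℕ) (e : ℕ → Event) (k τ t : ℕ) : Prop where
  left : Agreed n₁ e τ
  right : Agreed n₁ e t
  lt : τ < t
  between : ∀ s, τ < s → s < t → ¬ Agreed n₁ e s
  index : cycleOf n₁ e (τ + 1) = k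

theorem cycleOf_one (n₁ : ℕ) (e : ℕ → Event) : cycleOf n₁ e 1 = 0 := by
  simp [cycleOf]

theorem cycleOf_succ_of_agreed {b : ℕ} (hb : 1 ≤ b) (h : Agreed n₁ e b) :
    cycleOf n₁ e (b + 1) = cycleOf n₁ e b + 1 := by
  classical
  rw [cycleOf, ← Finset.insert_Ico_right_eq_Ico_add_one hb,
    Finset.filter_insert, if_pos (by exact h), Finset.card_insert_of_notMem (by simp), cycleOf]

theorem cycleOf_succ_of_not_agreed {b : ℕ} (hb : 1 ≤ b) (h : ¬ Agreed n₁ e b) :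
    cycleOf n₁ e (b + 1) = cycleOf n₁ e b := by
  classical
  rw [cycleOf, ← Finset.insert_Ico_right_eq_Ico_add_one hb,
    Finset.filter_insert, if_neg (by exact h), cycleOf]

theorem cycleOf_mono (n₁ : ℕ) (e : ℕ → Event) : Monotone (cycleOf n₁ e) := by
  intro a b hab
  unfold cycleOf
  exact Finset.card_le_card (Finset.filter_subset_filter _ (Finset.Ico_subset_Ico le_rfl hab))

theorem IsCycle.cycleOf_eq {k τ t : ℕ} (h : IsCycle n₁ e k τ t) {b : ℕ} (h1 : τ < b)
    (h2 : b ≤ t) : cycleOf n₁ e b = k := by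
  induction b, h1 using Nat.le_induction with
  | base => exact h.index
  | succ b hb ih =>
    have hb' : τ < b := hb
    rw [cycleOf_succ_of_not_agreed (by omega) (h.between b hb' (by omega)), ih (by omega)]

theorem IsCycle.cycleOf_right {k τ t : ℕ} (h : IsCycle n₁ e k τ t) :
    cycleOf n₁ e (t + 1) = k + 1 := by
  have := h.lt
  rw [cycleOf_succ_of_agreed (by omega) h.right, h.cycleOf_eq h.lt le_rfl]

/-- The genesis block must be excluded: `cycleOf` gives it the index `0` as well. -/
theorem IsCycle.cycleOf_iff {k τ t : ℕ} (h : IsCycle n₁ e k τ t) {b : ℕ} (hb : 1 ≤ b) :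
    cycleOf n₁ e b = k ↔ τ < b ∧ b ≤ t := by
  refine ⟨fun hk => ⟨?_, ?_⟩, fun hk => h.cycleOf_eq hk.1 hk.2⟩
  · by_contra! hcon
    have h1 := cycleOf_succ_of_agreed (by omega) h.left
    have h2 := cycleOf_mono n₁ e hcon
    have h3 := h.index
    omega
  · by_contra! hcon
    have h1 := cycleOf_mono n₁ e (show t + 1 ≤ b from hcon)
    have h2 := h.cycleOf_right
    omega

section Count

variable {n τ t t' : ℕ} {o : Outcome}

theorem IsCycle.isUncle_iff (h : IsCycle n₁ e n τ t) {u : ℕ} (h1 : τ < u) (h2 : u ≤ t) :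
    IsUncle n₁ e u ↔ ¬ Anc n₁ e u (secretAt n₁ e t) ∧
      Anc n₁ e (parentOf n₁ e u) (secretAt n₁ e t) := by
  rw [IsUncle, isOfficial_iff h.right h2, ← parentOf,
    isOfficial_iff h.right ((parentOf_le _ _ _).trans h2)]
  exact and_iff_right (by omega)

/-- The first official block of the next cycle signals exactly the pending uncles, and later blocks
signal no uncles of the cycle. -/
theorem IsCycle.isNephew_iff (h : IsCycle n₁ e n τ t) (h' : IsCycle n₁ e (n + 1) t t')
    {f : ℕ} (f1 : t < f) (f2 : f ≤ t') (f3 : Anc n₁ e f (secretAt n₁ e t'))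
    (f4 : parentOf n₁ e f = secretAt n₁ e t) {N u : ℕ} (hu1 : τ < u) (hu2 : u ≤ t)
    (hN : t < N) :
    IsNephew n₁ e N u ↔ N = f ∧ u ∈ pendingUncles n₁ e τ t := by
  have hfo : IsOfficial n₁ e f := (isOfficial_iff h'.right f2).2 f3
  have hfh := heightOf_eq (n₁ := n₁) (e := e) (b := f) (by omega)
  rw [f4] at hfh
  have huh := heightOf_le_secretAt n₁ e t u hu2
  constructor
  · rintro ⟨hu, hN1, hNo, hmem⟩
    obtain ⟨m1, m2, m3, m4⟩ := (mem_refs_iff_of_isUncle hu hN1 hNo).1 hmem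
    have hso : IsOfficial n₁ e (secretAt n₁ e t) :=
      (isOfficial_iff h.right (secretAt_le _ _ _)).2 (Anc.refl _ _ _)
    have hlt := (hso.anc_of_le hNo ((secretAt_le _ _ _).trans hN.le)).heightOf_lt
      ((secretAt_le _ _ _).trans_lt hN)
    -- `f` is the lowest official block above the agreed tip, so `N` is not older than `f`; a later
    -- `N` would come after `f`, which already overtakes every block of the cycle.
    have hfN := (hfo.anc_of_heightOf_le hNo (by omega)).le
    have hNf : N = f := by
      by_contra hne
      have := m4 f hfo (by omega) (by omega)
      omega
    subst hNf
    obtain ⟨u1, u2⟩ := (h.isUncle_iff hu1 hu2).1 hu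
    refine ⟨rfl, hu1, hu2, u1, u2, ?_, by omega⟩
    intro a a1 a2 a3
    exact m4 a ((isOfficial_iff h.right a2).2 a3) (by omega) a1
  · rintro ⟨rfl, -, -, u1, u2, u3, u4⟩
    have hu := (h.isUncle_iff hu1 hu2).2 ⟨u1, u2⟩
    refine ⟨hu, by omega, hfo, (mem_refs_iff_of_isUncle hu (by omega) hfo).2
      ⟨by omega, by omega, by omega, ?_⟩⟩
    intro a a1 a2 a3
    -- An official block younger than `t` is above the agreed tip, hence descends from `f` and
    -- cannot precede it.
    rcases Nat.lt_or_ge t a with hlt | hle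
    · have hpa := heightOf_eq (n₁ := n₁) (e := e) (b := a) (by omega)
      have hso : IsOfficial n₁ e (secretAt n₁ e t) :=
        (isOfficial_iff h.right (secretAt_le _ _ _)).2 (Anc.refl _ _ _)
      have := (hso.anc_of_le a1 ((secretAt_le _ _ _).trans hlt.le)).heightOf_lt
        ((secretAt_le _ _ _).trans_lt hlt)
      have := (hfo.anc_of_heightOf_le a1 (by omega)).le
      omega
    · exact u3 a a3 hle ((isOfficial_iff h.right hle).1 a1)

theorem IsCycle.laterReferredUncles_eq (h : IsCycle n₁ e n τ t) (h' : IsCycle n₁ e (n + 1) t t')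
    {f : ℕ} (f1 : t < f) (f2 : f ≤ t') (f3 : Anc n₁ e f (secretAt n₁ e t'))
    (f4 : parentOf n₁ e f = secretAt n₁ e t) :
    laterReferredUncles n₁ n e = (pendingUncles n₁ e τ t).ncard := by
  unfold laterReferredUncles
  congr 1
  ext u
  simp only [Set.mem_ofPred_eq]
  constructor
  · rintro ⟨hu, N, hN, hcN⟩
    obtain ⟨hu1, hu2⟩ := (h.cycleOf_iff hN.1.1).1 hu
    have hNt : t < N := by
      by_contra! hcon
      have := cycleOf_mono n₁ e hcon
      rw [h.cycleOf_eq h.lt le_rfl] at this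
      omega
    exact ((h.isNephew_iff h' f1 f2 f3 f4 hu1 hu2 hNt).1 hN).2
  · intro hu
    refine ⟨h.cycleOf_eq hu.1 hu.2.1, f,
      (h.isNephew_iff h' f1 f2 f3 f4 hu.1 hu.2.1 f1).2 ⟨rfl, hu⟩, ?_⟩
    rw [h'.cycleOf_eq f1 f2]
    omega

/-- An honest nephew is found either within the cycle, which gives `ownUncles`, or later, and then
it is `f`, which signals all pending uncles at once. -/
theorem IsCycle.honestReferredUncles_eq (h : IsCycle n₁ e n τ t)
    (h' : IsCycle n₁ e (n + 1) t t') {f : ℕ} (f1 : t < f) (f2 : f ≤ t')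
    (f3 : Anc n₁ e f (secretAt n₁ e t')) (f4 : parentOf n₁ e f = secretAt n₁ e t) {b : Bool}
    (f5 : (blockOf n₁ e f).miner = Miner.honest ↔ b = true) :
    honestReferredUncles n₁ n e = (ownUncles n₁ e τ t).ncard +
      if b = true then (pendingUncles n₁ e τ t).ncard else 0 := by
  have hown : ∀ N u, τ < u → u ≤ t → N ≤ t → (IsNephew n₁ e N u ↔ IsUncle n₁ e u ∧ u < N ∧
      Anc n₁ e N (secretAt n₁ e t) ∧ heightOf n₁ e u < heightOf n₁ e N ∧
      heightOf n₁ e N ≤ heightOf n₁ e u + n₁ ∧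
      ∀ a, Anc n₁ e a (secretAt n₁ e t) → a < N → u < a →
        heightOf n₁ e a ≤ heightOf n₁ e u) := by
    intro N u hu1 hu2 hN
    refine and_congr_right fun hu => ?_
    constructor
    · rintro ⟨h1, h2, h3⟩
      obtain ⟨m1, m2, m3, m4⟩ := (mem_refs_iff_of_isUncle hu h1 h2).1 h3
      exact ⟨m1, (isOfficial_iff h.right hN).1 h2, m2, m3, fun a ha ha' =>
        m4 a ((isOfficial_iff h.right (by omega)).2 ha) ha'⟩
    · rintro ⟨m1, m5, m2, m3, m4⟩
      have h2 := (isOfficial_iff h.right hN).2 m5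
      exact ⟨by omega, h2, (mem_refs_iff_of_isUncle hu (by omega) h2).2 ⟨m1, m2, m3, fun a ha ha' =>
        m4 a ((isOfficial_iff h.right (by omega)).1 ha) ha'⟩⟩
  have hset : {u | cycleOf n₁ e u = n ∧ ∃ N, IsNephew n₁ e N u ∧
      (blockOf n₁ e N).miner = Miner.honest} = ownUncles n₁ e τ t ∪
      (if b = true then pendingUncles n₁ e τ t else ∅) := by
    ext u
    simp only [Set.mem_ofPred_eq, Set.mem_union]
    constructor
    · rintro ⟨hu, N, hN, hm⟩
      obtain ⟨hu1, hu2⟩ := (h.cycleOf_iff hN.1.1).1 hu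
      rcases Nat.lt_or_ge t N with hlt | hle
      · obtain ⟨rfl, hp⟩ := (h.isNephew_iff h' f1 f2 f3 f4 hu1 hu2 hlt).1 hN
        right
        rw [if_pos (f5.1 hm)]
        exact hp
      · left
        obtain ⟨m0, m1, m2, m3, m4, m5⟩ := (hown N u hu1 hu2 hle).1 hN
        obtain ⟨u1, u2⟩ := (h.isUncle_iff hu1 hu2).1 m0
        exact ⟨hu1, hu2, u1, u2, N, m1, hle, m2, hm, m3, m4, m5⟩
    · rintro (⟨hu1, hu2, u1, u2, N, m1, hle, m2, hm, m3, m4, m5⟩ | hu)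
      · exact ⟨h.cycleOf_eq hu1 hu2, N, (hown N u hu1 hu2 hle).2
          ⟨(h.isUncle_iff hu1 hu2).2 ⟨u1, u2⟩, m1, m2, m3, m4, m5⟩, hm⟩
      · split_ifs at hu with hb
        · exact ⟨h.cycleOf_eq hu.1 hu.2.1, f,
            (h.isNephew_iff h' f1 f2 f3 f4 hu.1 hu.2.1 f1).2 ⟨rfl, hu⟩, f5.2 hb⟩
        · exact absurd hu (Set.notMem_empty u)
  rw [honestReferredUncles, hset]
  split_ifs with hb
  -- A nephew inside the cycle is a younger and higher block on the chain, which a pending uncle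
  -- does not have.
  · refine Set.ncard_union_eq ?_ (ownUncles_finite _ _ _ _) (pendingUncles_finite _ _ _ _)
    rw [Set.disjoint_left]
    rintro u ⟨-, -, -, -, N, m1, hle, m2, -, m3, -⟩ ⟨-, -, -, -, u3, -⟩
    have := u3 N m1 hle m2
    omega
  · rw [Set.union_empty, Nat.add_zero]

end Count

/-- How the summary after `t` events describes the trajectory. -/
structure SummarySpec (n₁ n : ℕ) (e : ℕ → Event) (t τ : ℕ) (x : Summary) : Prop where
  agreed : Agreed n₁ e τ
  le : τ ≤ t
  phase : PhaseSpec n₁ e τ t x.phase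
  between : ∀ s, τ < s → s ≤ t → ¬ Agreed n₁ e s
  cycle : cycleOf n₁ e (τ + 1) = x.cycle
  next : x.cycle = n + 1 → ∃ τ₀ o, IsCycle n₁ e n τ₀ τ ∧ OutcomeSpec n₁ e τ₀ τ o ∧
    x.pending = o.pending ∧ x.count = o.own
  later : n + 2 ≤ x.cycle →
    laterReferredUncles n₁ n e = x.pending ∧ honestReferredUncles n₁ n e = x.count

/-- Induction on the events. The counts of cycle `n` become known only when cycle `n + 1` ends and
its first official block is determined; until then `next` keeps the data of cycle `n`. -/
theorem exists_summarySpec (hn₁ : 1 ≤ n₁) (n : ℕ) (e : ℕ → Event) (t : ℕ) :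
    ∃ τ, SummarySpec n₁ n e t τ (summary n₁ n e t) := by
  induction t with
  | zero =>
    refine ⟨0, agreed_zero _ _, le_rfl, rfl, fun s h1 h2 => by omega, cycleOf_one _ _, ?_, ?_⟩
    · simp [summary, Summary.init]
    · simp [summary, Summary.init]
  | succ t ih =>
    obtain ⟨τ, ih⟩ := ih
    rw [summary]
    set x := summary n₁ n e t with hx
    obtain ⟨k1, k2⟩ := phaseSpec_next hn₁ ih.agreed x.phase ih.phase
    unfold Summary.step
    rcases hnext : x.phase.next n₁ (e t) with ph | o
    · obtain ⟨p1, p2⟩ := k1 ph hnext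
      refine ⟨τ, ih.agreed, ih.le.trans (Nat.le_succ t), p1, ?_, ih.cycle, ih.next, ih.later⟩
      intro s h1 h2
      rcases Nat.lt_or_ge t s with hlt | hle
      · obtain rfl : s = t + 1 := by omega
        exact p2
      · exact ih.between s h1 hle
    · obtain ⟨p1, p2⟩ := k2 o hnext
      have hle := ih.le
      have hc : IsCycle n₁ e x.cycle τ (t + 1) :=
        ⟨ih.agreed, p2, by omega, fun s h1 h2 => ih.between s h1 (by omega), ih.cycle⟩
      refine ⟨t + 1, p2, le_rfl, ?_, fun s h1 h2 => by omega, ?_, ?_, ?_⟩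
      · rw [Summary.finish_phase]
        rfl
      · rw [Summary.finish_cycle]
        exact hc.cycleOf_right
      · rw [Summary.finish_cycle]
        intro hk
        have hk' : x.cycle = n := by omega
        refine ⟨τ, o, hk' ▸ hc, p1, ?_⟩
        simp [Summary.finish, hk']
      · rw [Summary.finish_cycle]
        intro hk
        rcases Nat.lt_or_ge x.cycle (n + 2) with hlt | hge
        · have hk' : x.cycle = n + 1 := by omega
          obtain ⟨τ₀, o₀, q1, q2, q3, q4⟩ := ih.next hk'
          obtain ⟨f, f1, f2, f3, f4, f5⟩ := p1.first
          rw [hk'] at hc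
          rw [q1.laterReferredUncles_eq hc f1 f2 f3 f4,
            q1.honestReferredUncles_eq hc f1 f2 f3 f4 f5, q2.pending, q2.own]
          simp only [Summary.finish, hk', Nat.succ_ne_self, if_false, true_and]
          split_ifs <;> simp [q3, q4]
        · have h1 : x.cycle ≠ n := by omega
          have h2 : x.cycle ≠ n + 1 := by omega
          simpa [Summary.finish, h1, h2] using ih.later hge

theorem referredUncles_eq (hn₁ : 1 ≤ n₁) {n : ℕ} {e : ℕ → Event} {t : ℕ}
    (h : n + 2 ≤ (summary n₁ n e t).cycle) :
    laterReferredUncles n₁ n e = (summary n₁ n e t).pending ∧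
      honestReferredUncles n₁ n e = (summary n₁ n e t).count := by
  obtain ⟨τ, hτ⟩ := exists_summarySpec hn₁ n e t
  exact hτ.later h

end SelfishMining

/-! ### Harmonic functions of the chain of summaries -/

namespace SelfishMining

section Mean

/-- The mean of a function of one mining event. -/
def eventMean (q γ : ℝ) (g : Event → ℝ) : ℝ :=
  q * (γ * g (Miner.selfish, true) + (1 - γ) * g (Miner.selfish, false)) +
    (1 - q) * (γ * g (Miner.honest, true) + (1 - γ) * g (Miner.honest, false))

theorem eventMean_const (q γ c : ℝ) : eventMean q γ (fun _ => c) = c := by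
  unfold eventMean
  ring

/-- The mean after the next event of a function of the phase or of the outcome. -/
def phaseMean (n₁ : ℕ) (q γ : ℝ) (a : Phase → ℝ) (b : Outcome → ℝ) (ph : Phase) : ℝ :=
  eventMean q γ fun ev => Sum.elim a b (ph.next n₁ ev)

theorem eventMean_step {n₁ n : ℕ} (q γ : ℝ) (f : Summary → ℝ) (x : Summary) (a : Phase → ℝ)
    (b : Outcome → ℝ) (ha : ∀ ph, f ⟨x.cycle, ph, x.pending, x.count⟩ = a ph)
    (hb : ∀ o, f (x.finish n o) = b o) :
    eventMean q γ (fun ev => f (x.step n₁ n ev)) = phaseMean n₁ q γ a b x.phase := by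
  unfold phaseMean
  congr 1
  funext ev
  unfold Summary.step
  rcases x.phase.next n₁ ev with ph | o
  · exact ha ph
  · exact hb o

theorem phaseMean_const (n₁ : ℕ) (q γ c : ℝ) (ph : Phase) :
    phaseMean n₁ q γ (fun _ => c) (fun _ => c) ph = c := by
  have : ∀ ev, Sum.elim (fun _ : Phase => c) (fun _ : Outcome => c) (ph.next n₁ ev) = c := by
    intro ev
    rcases ph.next n₁ ev with _ | _ <;> rfl
  simp only [phaseMean, this, eventMean_const]

theorem phaseMean_add_mul (n₁ : ℕ) (q γ c d : ℝ) (a a' : Phase → ℝ) (b b' : Outcome → ℝ)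
    (ph : Phase) :
    phaseMean n₁ q γ (fun x => c * a x + d * a' x) (fun x => c * b x + d * b' x) ph =
      c * phaseMean n₁ q γ a b ph + d * phaseMean n₁ q γ a' b' ph := by
  have : ∀ ev, Sum.elim (fun x => c * a x + d * a' x) (fun x => c * b x + d * b' x)
      (ph.next n₁ ev) =
      c * Sum.elim a b (ph.next n₁ ev) + d * Sum.elim a' b' (ph.next n₁ ev) := by
    intro ev
    rcases ph.next n₁ ev with _ | _ <;> rfl
  simp only [phaseMean, this, eventMean]
  ring

/-- The probability to reach the end of the cycle by at least `j + 1` honest blocks in a row still to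
come, when the fork of the attacker leads by `m + 1` blocks. -/
def finalRunProb (p q : ℝ) (m j : ℕ) : ℝ :=
  ∑ k ∈ Finset.range (min m (j + 1)), p ^ k * q ^ (j - k)

/-- One-step analysis at lead `m + 2`. If the next block is honest and `m = j`, it starts a run of
exactly `j + 1` honest blocks when the `m` following ones are honest too: this is the extra term `p
^ m`. -/
theorem finalRunProb_succ {p q : ℝ} (hpq : p + q = 1) (m j : ℕ) :
    finalRunProb p q (m + 1) j = p * (finalRunProb p q m j + if m = j then p ^ m else 0) +
      q * finalRunProb p q (m + 2) j := by
  obtain rfl : p = 1 - q := by linarith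
  unfold finalRunProb
  rcases lt_trichotomy m j with h | rfl | h
  · rw [min_eq_left (by omega), min_eq_left (by omega), min_eq_left (by omega), if_neg (by omega),
      Finset.sum_range_succ _ (m + 1), Finset.sum_range_succ _ m]
    obtain ⟨d, rfl⟩ : ∃ d, j = m + 1 + d := ⟨j - (m + 1), by omega⟩
    rw [show m + 1 + d - m = d + 1 by omega, show m + 1 + d - (m + 1) = d by omega]
    ring
  · rw [min_eq_left (by omega), min_eq_left (by omega), min_eq_right (by omega), if_pos rfl,
      Finset.sum_range_succ _ m, Nat.sub_self]
    ring
  · rw [min_eq_right (by omega), min_eq_right (by omega), min_eq_right (by omega),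
      if_neg (by omega)]
    ring

/-- The sum over `j` of `finalRunProb p q m j`, for the distances `j + 2 ≤ n₁`. -/
def finalRunSum (n₁ : ℕ) (p q : ℝ) (m : ℕ) : ℝ :=
  ∑ j ∈ Finset.range (n₁ - 1), finalRunProb p q m j

theorem finalRunSum_zero (n₁ : ℕ) (p q : ℝ) : finalRunSum n₁ p q 0 = 0 := by
  simp [finalRunSum, finalRunProb]

theorem finalRunSum_succ {p q : ℝ} (hpq : p + q = 1) (n₁ m : ℕ) :
    finalRunSum n₁ p q (m + 1) = p * (finalRunSum n₁ p q m + if m + 2 ≤ n₁ then p ^ m else 0) +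
      q * finalRunSum n₁ p q (m + 2) := by
  have h : (if m + 2 ≤ n₁ then p ^ m else 0) =
      ∑ j ∈ Finset.range (n₁ - 1), if m = j then p ^ m else 0 := by
    rw [Finset.sum_ite_eq]
    simp only [Finset.mem_range]
    exact if_congr (by omega) rfl rfl
  unfold finalRunSum
  rw [h, ← Finset.sum_add_distrib, Finset.mul_sum, Finset.mul_sum, ← Finset.sum_add_distrib]
  exact Finset.sum_congr rfl fun j _ => finalRunProb_succ hpq m j

/-- The probability, when the fork leads by `i + 2` blocks and there is no honest block, that from
the first honest block on, the cycle has only honest blocks, and that this block can be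
signaled in the next cycle. -/
def singleRunSum (n₁ : ℕ) (p q : ℝ) (i : ℕ) : ℝ :=
  ∑ l ∈ Finset.range (n₁ - 1 - i), q ^ l * p ^ (l + i + 1)

/-- The index `l` is the number of attacker blocks before the first honest one; the term `l = 0` is
split off. -/
theorem singleRunSum_eq (n₁ : ℕ) (p q : ℝ) (i : ℕ) :
    singleRunSum n₁ p q i =
      p * (if i + 2 ≤ n₁ then p ^ i else 0) + q * singleRunSum n₁ p q (i + 1) := by
  unfold singleRunSum
  split_ifs with h
  · rw [show n₁ - 1 - i = n₁ - 1 - (i + 1) + 1 by omega, Finset.sum_range_succ', Finset.mul_sum]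
    rw [add_comm]
    congr 1
    · ring
    · refine Finset.sum_congr rfl fun l _ => ?_
      rw [show l + 1 + i + 1 = l + (i + 1) + 1 by omega]
      ring
  · rw [show n₁ - 1 - i = 0 by omega, show n₁ - 1 - (i + 1) = 0 by omega]
    simp

/-- The expected number of uncles which the current cycle will leave to the next one. -/
def pendingMean (n₁ : ℕ) (q γ : ℝ) : Phase → ℝ
  | Phase.agree =>
    q * (q * (γ * finalRunSum n₁ (1 - q) q 1 + (1 - γ) * singleRunSum n₁ (1 - q) q 0))
  | Phase.lead => q * (γ * finalRunSum n₁ (1 - q) q 1 + (1 - γ) * singleRunSum n₁ (1 - q) q 0)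
  | Phase.tie => 0
  | Phase.fork i fresh c => (1 - q) ^ (i + 1) * c + γ * finalRunSum n₁ (1 - q) q (i + 1) +
      if fresh = true then (1 - γ) * singleRunSum n₁ (1 - q) q i else 0

/-- In a fork, the `c` pending uncles survive only if the next `i + 1` blocks are all honest. The
weight of a new honest block has mean `γ`, plus `1 - γ` while `fresh` holds, so the identity is a
combination of the recursions of `finalRunSum` and `singleRunSum` with these coefficients. -/
theorem phaseMean_pendingMean (n₁ : ℕ) (q γ : ℝ) (ph : Phase) :
    phaseMean n₁ q γ (pendingMean n₁ q γ) (fun o => o.pending) ph = pendingMean n₁ q γ ph := by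
  have hpq : (1 - q) + q = 1 := by ring
  match ph with
  | .agree => simp [-mul_eq_mul_left_iff, phaseMean, eventMean, Phase.next, pendingMean]; ring
  | .lead => simp [-mul_eq_mul_left_iff, phaseMean, eventMean, Phase.next, pendingMean]; ring
  | .tie => simp [phaseMean, eventMean, Phase.next, pendingMean]
  | .fork 0 fresh c =>
    have h1 := finalRunSum_succ hpq n₁ 0
    have h2 := singleRunSum_eq n₁ (1 - q) q 0
    rw [finalRunSum_zero] at h1
    simp only [zero_add] at h1 h2
    cases fresh <;> by_cases hn : 2 ≤ n₁ <;>
      simp only [phaseMean, eventMean, Phase.next, pendingMean, uncleWeight, Sum.elim_inl,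
        Sum.elim_inr, hn, if_true, if_false, Bool.false_eq_true, or_true, true_or, or_self,
        and_true, and_false, zero_add, pow_zero] at h1 h2 ⊢ <;> push_cast
    · linear_combination -γ * h1
    · linear_combination -γ * h1
    · linear_combination -γ * h1 - (1 - γ) * h2
    · linear_combination -γ * h1 - (1 - γ) * h2
  | .fork (i + 1) fresh c =>
    have h1 := finalRunSum_succ hpq n₁ (i + 1)
    have h2 := singleRunSum_eq n₁ (1 - q) q (i + 1)
    cases fresh <;> by_cases hn : i + 1 + 2 ≤ n₁ <;>
      simp only [phaseMean, eventMean, Phase.next, pendingMean, uncleWeight, Sum.elim_inl, hn,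
        if_true, if_false, Bool.false_eq_true, or_true, true_or, or_self, and_true,
        and_false] at h1 h2 ⊢ <;> push_cast
    · linear_combination -γ * h1
    · linear_combination -γ * h1
    · linear_combination -γ * h1 - (1 - γ) * h2
    · linear_combination -γ * h1 - (1 - γ) * h2

/-- The expected number of uncles of the current cycle with an honest nephew in the cycle. -/
def ownMean (q : ℝ) : Phase → ℝ
  | Phase.agree => q * (1 - q) ^ 2
  | Phase.lead => (1 - q) ^ 2
  | Phase.tie => 1 - q
  | Phase.fork _ _ _ => 0

theorem phaseMean_ownMean (n₁ : ℕ) (q γ : ℝ) (ph : Phase) :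
    phaseMean n₁ q γ (ownMean q) (fun o => o.own) ph = ownMean q ph := by
  match ph with
  | .agree => simp [-mul_eq_mul_left_iff, phaseMean, eventMean, Phase.next, ownMean]; ring
  | .lead => simp [phaseMean, eventMean, Phase.next, ownMean]; ring
  | .tie => simp [phaseMean, eventMean, Phase.next, ownMean]
  | .fork 0 fresh c => simp [phaseMean, eventMean, Phase.next, ownMean]
  | .fork (i + 1) fresh c => simp [phaseMean, eventMean, Phase.next, ownMean]

/-- The probability that the first official block of the current cycle will be honest. -/
def firstMean (q γ : ℝ) : Phase → ℝ
  | Phase.agree => (1 - q) + q * (1 - q) ^ 2 * (1 - γ)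
  | Phase.lead => (1 - q) ^ 2 * (1 - γ)
  | Phase.tie => (1 - q) * (1 - γ)
  | Phase.fork _ _ _ => 0

theorem phaseMean_firstMean (n₁ : ℕ) (q γ : ℝ) (ph : Phase) :
    phaseMean n₁ q γ (firstMean q γ) (fun o => if o.honestFirst = true then 1 else 0) ph =
      firstMean q γ ph := by
  match ph with
  | .agree => simp [phaseMean, eventMean, Phase.next, firstMean]; ring
  | .lead => simp [phaseMean, eventMean, Phase.next, firstMean]; ring
  | .tie => simp [phaseMean, eventMean, Phase.next, firstMean]
  | .fork 0 fresh c => simp [phaseMean, eventMean, Phase.next, firstMean]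
  | .fork (i + 1) fresh c => simp [phaseMean, eventMean, Phase.next, firstMean]

/-- The expected time until the end of the current cycle. -/
noncomputable def timeMean (q : ℝ) : Phase → ℝ
  | Phase.agree => 1 + q * (1 + (1 - q) + q / (1 - 2 * q))
  | Phase.lead => 1 + (1 - q) + q / (1 - 2 * q)
  | Phase.tie => 1
  | Phase.fork i _ _ => (i + 1) / (1 - 2 * q)

/-- The lead decreases on average by `(1 - q) - q = 1 - 2 * q` per event, and a fork ends after a
net loss of `i + 1`. -/
theorem phaseMean_timeMean {q : ℝ} (hq : q < 1 / 2) (n₁ : ℕ) (γ : ℝ) (ph : Phase) :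
    phaseMean n₁ q γ (timeMean q) (fun _ => 0) ph = timeMean q ph - 1 := by
  have h : 1 - 2 * q ≠ 0 := by
    intro h
    linarith
  have hinv := mul_inv_cancel₀ h
  match ph with
  | .agree => simp [-mul_eq_mul_left_iff, phaseMean, eventMean, Phase.next, timeMean]; ring
  | .lead => simp [phaseMean, eventMean, Phase.next, timeMean]; ring
  | .tie => simp [phaseMean, eventMean, Phase.next, timeMean]
  | .fork 0 fresh c =>
    simp only [phaseMean, eventMean, Phase.next, timeMean, Sum.elim_inl, Sum.elim_inr]
    push_cast
    simp only [div_eq_mul_inv]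
    linear_combination -hinv
  | .fork (i + 1) fresh c =>
    simp only [phaseMean, eventMean, Phase.next, timeMean, Sum.elim_inl]
    push_cast
    simp only [div_eq_mul_inv]
    linear_combination -hinv

theorem timeMean_nonneg {q : ℝ} (hq0 : 0 ≤ q) (hq : q < 1 / 2) (ph : Phase) :
    0 ≤ timeMean q ph := by
  have h : 0 < 1 - 2 * q := by linarith
  have h' : 0 < 1 - q := by linarith
  cases ph <;> simp only [timeMean] <;> positivity

/-- The conditional expectation of the number of pending uncles of cycle `n`. -/
noncomputable def laterMean (n₁ n : ℕ) (q γ : ℝ) (x : Summary) : ℝ :=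
  if x.cycle < n then pendingMean n₁ q γ Phase.agree
  else if x.cycle = n then pendingMean n₁ q γ x.phase else x.pending

/-- Constant before cycle `n`, harmonic in the phase during it, frozen afterwards; the values agree
at the transitions because each cycle restarts in `Phase.agree`. -/
theorem eventMean_laterMean (n₁ n : ℕ) (q γ : ℝ) (x : Summary) :
    eventMean q γ (fun ev => laterMean n₁ n q γ (x.step n₁ n ev)) = laterMean n₁ n q γ x := by
  rcases lt_trichotomy x.cycle n with h | h | h
  · rw [eventMean_step q γ _ x (fun _ => pendingMean n₁ q γ Phase.agree)
      (fun _ => pendingMean n₁ q γ Phase.agree), phaseMean_const, laterMean, if_pos h]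
    · intro ph
      rw [laterMean, if_pos h]
    · intro o
      rw [laterMean, Summary.finish_cycle, Summary.finish_phase]
      split_ifs <;> first | rfl | omega
  · rw [eventMean_step q γ _ x (pendingMean n₁ q γ) (fun o => o.pending), phaseMean_pendingMean,
      laterMean, if_neg (by omega), if_pos h]
    · intro ph
      rw [laterMean, if_neg (by simp [h]), if_pos h]
    · intro o
      rw [laterMean, Summary.finish_cycle, if_neg (by omega), if_neg (by omega), Summary.finish,
        if_pos h]
  · rw [eventMean_step q γ _ x (fun _ => x.pending) (fun _ => x.pending), phaseMean_const,
      laterMean, if_neg (by omega), if_neg (by omega)]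
    · intro ph
      rw [laterMean, if_neg h.le.not_gt, if_neg h.ne']
    · intro o
      rw [laterMean, Summary.finish_cycle, if_neg (by omega), if_neg (by omega), Summary.finish,
        if_neg (by omega)]
      split_ifs <;> rfl

/-- The conditional expectation of the number of uncles of cycle `n` with an honest nephew. -/
noncomputable def honestMean (n₁ n : ℕ) (q γ : ℝ) (x : Summary) : ℝ :=
  if x.cycle < n then
    ownMean q Phase.agree + firstMean q γ Phase.agree * pendingMean n₁ q γ Phase.agree
  else if x.cycle = n then
    ownMean q x.phase + firstMean q γ Phase.agree * pendingMean n₁ q γ x.phase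
  else if x.cycle = n + 1 then x.count + x.pending * firstMean q γ x.phase
  else x.count

/-- During cycle `n` the factor `firstMean q γ Phase.agree` belongs to a cycle not yet begun, hence
is a constant; during cycle `n + 1` the number of pending uncles is the constant. So each regime is
a linear combination of harmonic functions. -/
theorem eventMean_honestMean (n₁ n : ℕ) (q γ : ℝ) (x : Summary) :
    eventMean q γ (fun ev => honestMean n₁ n q γ (x.step n₁ n ev)) = honestMean n₁ n q γ x := by
  rcases lt_trichotomy x.cycle n with h | h | h
  · set c := ownMean q Phase.agree + firstMean q γ Phase.agree * pendingMean n₁ q γ Phase.agree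
      with hc
    rw [eventMean_step q γ _ x (fun _ => c) (fun _ => c), phaseMean_const, honestMean, if_pos h]
    · intro ph
      rw [honestMean, if_pos h]
    · intro o
      rw [honestMean, Summary.finish_cycle, Summary.finish_phase]
      split_ifs <;> first | rfl | omega
  · have key := phaseMean_add_mul n₁ q γ 1 (firstMean q γ Phase.agree) (ownMean q)
      (pendingMean n₁ q γ) (fun o => o.own) (fun o => o.pending) x.phase
    rw [phaseMean_ownMean, phaseMean_pendingMean] at key
    rw [eventMean_step q γ _ x _ _ ?_ ?_, key, honestMean, if_neg (by omega), if_pos h, one_mul]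
    · intro ph
      rw [honestMean, if_neg (by simp [h]), if_pos h, one_mul]
    · intro o
      rw [honestMean, Summary.finish_cycle, if_neg (by omega), if_neg (by omega),
        if_pos (by omega), Summary.finish, if_pos h]
      ring
  · rcases Nat.lt_or_ge (n + 1) x.cycle with h' | h'
    · rw [eventMean_step q γ _ x (fun _ => x.count) (fun _ => x.count), phaseMean_const,
        honestMean, if_neg (by omega), if_neg (by omega), if_neg (by omega)]
      · intro ph
        rw [honestMean, if_neg h.le.not_gt, if_neg h.ne', if_neg h'.ne']
      · intro o
        rw [honestMean, Summary.finish_cycle, if_neg (by omega), if_neg (by omega),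
          if_neg (by omega), Summary.finish, if_neg (by omega), if_neg (by omega)]
    · have h1 : x.cycle = n + 1 := by omega
      have key := phaseMean_add_mul n₁ q γ x.count x.pending (fun _ => 1)
        (firstMean q γ) (fun _ => 1) (fun o => if o.honestFirst = true then 1 else 0) x.phase
      rw [phaseMean_const, phaseMean_firstMean] at key
      rw [eventMean_step q γ _ x _ _ ?_ ?_, key, honestMean, if_neg (by omega), if_neg (by omega),
        if_pos h1, mul_one]
      · intro ph
        rw [honestMean, if_neg h.le.not_gt, if_neg h.ne', if_pos h1, mul_one]
      · intro o
        rw [honestMean, Summary.finish_cycle, if_neg (by omega), if_neg (by omega),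
          if_neg (by omega), Summary.finish, if_neg (by omega)]
        rcases ho : o.honestFirst with _ | _ <;> simp [h1]

/-- The expected time until the end of cycle `n + 1`. -/
noncomputable def remainingMean (n : ℕ) (q : ℝ) (x : Summary) : ℝ :=
  if x.cycle < n + 2 then timeMean q x.phase + (n + 1 - x.cycle) * timeMean q Phase.agree else 0

/-- The loss of exactly one per unfinished event makes the probabilities of being unfinished
summable over time. -/
theorem eventMean_remainingMean {q : ℝ} (hq : q < 1 / 2) (n₁ n : ℕ) (γ : ℝ) (x : Summary) :
    eventMean q γ (fun ev => remainingMean n q (x.step n₁ n ev)) =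
      remainingMean n q x - if x.cycle < n + 2 then 1 else 0 := by
  by_cases h : x.cycle < n + 2
  · have key := phaseMean_add_mul n₁ q γ 1 ((n + 1 - x.cycle) * timeMean q Phase.agree)
      (timeMean q) (fun _ => 1) (fun _ => 0) (fun _ => 1) x.phase
    rw [phaseMean_const, phaseMean_timeMean hq] at key
    rw [eventMean_step q γ _ x _ _ ?_ ?_, key, remainingMean, if_pos h, if_pos h]
    · ring
    · intro ph
      rw [remainingMean, if_pos h]
      ring
    · intro o
      rw [remainingMean, Summary.finish_cycle, Summary.finish_phase]
      split_ifs with h'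
      · push_cast
        ring
      · have h1 : x.cycle = n + 1 := by omega
        rw [h1]
        push_cast
        ring
  · rw [eventMean_step q γ _ x (fun _ => 0) (fun _ => 0), phaseMean_const, remainingMean,
      if_neg h, if_neg h, sub_zero]
    · intro ph
      rw [remainingMean, if_neg h]
    · intro o
      rw [remainingMean, Summary.finish_cycle, if_neg (by omega)]

theorem remainingMean_nonneg {q : ℝ} (hq0 : 0 ≤ q) (hq : q < 1 / 2) (n : ℕ) (x : Summary) :
    0 ≤ remainingMean n q x := by
  unfold remainingMean
  split_ifs with h
  · have h1 := timeMean_nonneg hq0 hq x.phase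
    have h2 := timeMean_nonneg hq0 hq Phase.agree
    have h3 : (x.cycle : ℝ) ≤ n + 1 := by exact_mod_cast Nat.lt_succ_iff.1 h
    have h4 : 0 ≤ (n + 1 - (x.cycle : ℝ)) := by linarith
    positivity
  · exact le_rfl

end Mean

end SelfishMining

/-! ### From one-step means to expectations under the mining law -/

open scoped Topology
namespace SelfishMining

section Law

instance : Finite Miner :=
  Finite.of_surjective (fun b : Bool => if b = true then Miner.selfish else Miner.honest) fun m => by
    cases m
    · exact ⟨true, rfl⟩
    · exact ⟨false, rfl⟩

instance : DiscreteMeasurableSpace Miner := ⟨fun _ => trivial⟩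

/-- The law of one mining event. -/
noncomputable abbrev eventLaw (q γ : unitInterval) : Measure Event :=
  (bernoulliMeasure Miner.selfish Miner.honest q).prod (bernoulliMeasure true false γ)

instance (q γ : unitInterval) : IsProbabilityMeasure (miningLaw q γ) := by
  unfold miningLaw
  infer_instance

theorem integral_eventLaw (q γ : unitInterval) (g : Event → ℝ) :
    ∫ ev, g ev ∂eventLaw q γ = eventMean q γ g := by
  rw [integral_prod _ Integrable.of_finite]
  simp only [integral_bernoulliMeasure, smul_eq_mul]
  rfl

variable {n₁ n : ℕ}

/-- A trajectory with a given beginning. -/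
def extend (t : ℕ) (z : Finset.range t → Event) (i : ℕ) : Event :=
  -- The continuation is arbitrary: the summary after `t` events ignores it.
  if h : i ∈ Finset.range t then z ⟨i, h⟩ else (Miner.honest, true)

theorem summary_congr {e e' : ℕ → Event} {t : ℕ} (h : ∀ i < t, e i = e' i) :
    summary n₁ n e t = summary n₁ n e' t := by
  induction t with
  | zero => rfl
  | succ t ih =>
    rw [summary, summary, ih fun i hi => h i (by omega), h t (by omega)]

theorem summary_extend (e : ℕ → Event) (t : ℕ) :
    summary n₁ n (extend t ((Finset.range t).restrict e)) t = summary n₁ n e t :=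
  summary_congr fun i hi => by simp [extend, hi]

/-- The summary factors through the first `t` events, a finite discrete space, where every function
is measurable. -/
theorem measurable_comp_summary (t : ℕ) (f : Summary → ℝ) :
    Measurable fun e => f (summary n₁ n e t) := by
  have h : (fun e => f (summary n₁ n e t)) =
      (fun z => f (summary n₁ n (extend t z) t)) ∘ (Finset.range t).restrict := by
    funext e
    simp [summary_extend]
  rw [h]
  exact Measurable.of_discrete.comp (Finset.measurable_restrict _)

theorem integrable_comp_summary (q γ : unitInterval) (t : ℕ) (f : Summary → ℝ) :
    Integrable (fun e => f (summary n₁ n e t)) (miningLaw q γ) := by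
  have h : (fun e => f (summary n₁ n e t)) =
      (fun z => f (summary n₁ n (extend t z) t)) ∘ (Finset.range t).restrict := by
    funext e
    simp [summary_extend]
  rw [h]
  exact Integrable.comp_measurable Integrable.of_finite (Finset.measurable_restrict _)

theorem indepFun_restrict_eval (q γ : unitInterval) (t : ℕ) :
    IndepFun (Finset.range t).restrict (fun e : ℕ → Event => e t) (miningLaw q γ) := by
  have h := iIndepFun_infinitePi (P := fun _ : ℕ => eventLaw q γ) (X := fun _ ω => ω)
    (fun _ => measurable_id)
  have h' := h.indepFun_finset (Finset.range t) {t} (by simp) (fun i => measurable_pi_apply i)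
  exact h'.comp (φ := id) (ψ := fun z : ({t} : Finset ℕ) → Event => z ⟨t, by simp⟩) measurable_id
    (measurable_pi_apply (⟨t, by simp⟩ : ({t} : Finset ℕ)))

/-- Event `t` is independent of the first `t` events, so it can be integrated out by Fubini. -/
theorem integral_summary_succ (q γ : unitInterval) (t : ℕ) (f : Summary → ℝ) :
    ∫ e, f (summary n₁ n e (t + 1)) ∂miningLaw q γ =
      ∫ e, eventMean q γ (fun ev => f ((summary n₁ n e t).step n₁ n ev)) ∂miningLaw q γ := by
  set G : (Finset.range t → Event) × Event → ℝ := fun z =>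
    f ((summary n₁ n (extend t z.1) t).step n₁ n z.2) with hG
  have hr : Measurable ((Finset.range t).restrict : (ℕ → Event) → _) :=
    Finset.measurable_restrict _
  have he : Measurable fun e : ℕ → Event => e t := measurable_pi_apply t
  have hGm : Measurable G := Measurable.of_discrete
  have hlaw : (miningLaw q γ).map (fun e : ℕ → Event => e t) = eventLaw q γ :=
    Measure.infinitePi_map_eval _ t
  calc ∫ e, f (summary n₁ n e (t + 1)) ∂miningLaw q γ
      = ∫ e, G ((Finset.range t).restrict e, e t) ∂miningLaw q γ := by
        simp only [hG, summary_extend, summary]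
    _ = ∫ z, G z ∂(miningLaw q γ).map fun e => ((Finset.range t).restrict e, e t) :=
        (integral_map (hr.prodMk he).aemeasurable hGm.aestronglyMeasurable).symm
    _ = ∫ z, G z ∂((miningLaw q γ).map (Finset.range t).restrict).prod (eventLaw q γ) := by
        rw [(indepFun_iff_map_prod_eq_prod_map_map hr.aemeasurable he.aemeasurable).1
          (indepFun_restrict_eval q γ t), hlaw]
    _ = ∫ z, eventMean q γ (fun ev => G (z, ev))
          ∂(miningLaw q γ).map (Finset.range t).restrict := by
        have := Measure.isProbabilityMeasure_map (μ := miningLaw q γ) hr.aemeasurable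
        rw [integral_prod _ Integrable.of_finite]
        simp only [integral_eventLaw]
    _ = ∫ e, eventMean q γ (fun ev => f ((summary n₁ n e t).step n₁ n ev)) ∂miningLaw q γ := by
        rw [integral_map hr.aemeasurable Measurable.of_discrete.aestronglyMeasurable]
        simp only [hG, summary_extend]

theorem integral_summary_of_harmonic (q γ : unitInterval) (f : Summary → ℝ)
    (hf : ∀ x : Summary, eventMean q γ (fun ev => f (x.step n₁ n ev)) = f x) (t : ℕ) :
    ∫ e, f (summary n₁ n e t) ∂miningLaw q γ = f Summary.init := by
  induction t with
  | zero => simp [summary]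
  | succ t ih => simp only [integral_summary_succ, hf, ih]

/-- Almost surely, cycle `n + 1` comes to an end. -/
theorem ae_exists_cycle (q γ : unitInterval) (hq : (q : ℝ) < 1 / 2) (n₁ n : ℕ) :
    ∀ᵐ e ∂miningLaw q γ, ∃ t, n + 2 ≤ (summary n₁ n e t).cycle := by
  set f : Summary → ℝ := fun x => if x.cycle < n + 2 then 1 else 0 with hf
  set P : ℕ → ℝ := fun t => ∫ e, f (summary n₁ n e t) ∂miningLaw q γ with hP
  have hf0 : ∀ x, 0 ≤ f x := fun x => by
    simp only [hf]
    split_ifs <;> norm_num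
  have hstep : ∀ t, ∫ e, remainingMean n q (summary n₁ n e (t + 1)) ∂miningLaw q γ =
      ∫ e, remainingMean n q (summary n₁ n e t) ∂miningLaw q γ - P t := by
    intro t
    rw [integral_summary_succ]
    simp only [eventMean_remainingMean hq]
    exact integral_sub (integrable_comp_summary q γ t (remainingMean n q))
      (integrable_comp_summary q γ t f)
  -- Telescoping: as the remaining mean is nonnegative, the partial sums of `P` are bounded by its
  -- initial value.
  have hsum : ∀ T, ∑ t ∈ Finset.range T, P t =
      remainingMean n q Summary.init -
        ∫ e, remainingMean n q (summary n₁ n e T) ∂miningLaw q γ := by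
    intro T
    induction T with
    | zero => simp [summary]
    | succ T ih =>
      rw [Finset.sum_range_succ, ih, hstep]
      ring
  have hP0 : ∀ t, 0 ≤ P t := fun t => integral_nonneg fun e => hf0 _
  have hlim : Filter.Tendsto P Filter.atTop (𝓝 0) := by
    refine (summable_of_sum_range_le (c := remainingMean n q Summary.init) hP0
      fun T => ?_).tendsto_atTop_zero
    rw [hsum, sub_le_self_iff]
    exact integral_nonneg fun e => remainingMean_nonneg q.2.1 hq n _
  rw [ae_iff]
  set A := {e : ℕ → Event | ¬ ∃ t, n + 2 ≤ (summary n₁ n e t).cycle} with hA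
  have hle : ∀ t, (miningLaw q γ).real A ≤ P t := by
    intro t
    set B := {e : ℕ → Event | (summary n₁ n e t).cycle < n + 2} with hB
    have hBm : MeasurableSet B := by
      have : B = (fun e => f (summary n₁ n e t)) ⁻¹' {1} := by
        ext e
        simp [hB, hf]
      rw [this]
      exact measurable_comp_summary t f (measurableSet_singleton 1)
    have hPB : P t = (miningLaw q γ).real B := by
      rw [← integral_indicator_one hBm]
      refine integral_congr_ae (Filter.Eventually.of_forall fun e => ?_)
      simp [hf, hB, Set.indicator_apply]
    rw [hPB]
    refine measureReal_mono fun e he => ?_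
    simp only [hA, Set.mem_ofPred_eq, not_exists, not_le] at he
    exact he t
  have h0 : (miningLaw q γ).real A ≤ 0 := ge_of_tendsto' hlim hle
  exact (measureReal_eq_zero_iff).1 (le_antisymm h0 measureReal_nonneg)

theorem cycle_mono (n₁ n : ℕ) (e : ℕ → Event) : Monotone fun t => (summary n₁ n e t).cycle := by
  refine monotone_nat_of_le_succ fun t => ?_
  rw [summary, Summary.step]
  rcases (summary n₁ n e t).phase.next n₁ (e t) with ph | o
  · exact le_rfl
  · simp

/-- A quantity whose conditional expectations are `f` has the mean `f Summary.init`. -/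
theorem integral_eq_of_harmonic (q γ : unitInterval) (hq : (q : ℝ) < 1 / 2) {f : Summary → ℝ}
    (hf : ∀ x : Summary, eventMean q γ (fun ev => f (x.step n₁ n ev)) = f x) {C : ℝ}
    (hC : ∀ e t, |f (summary n₁ n e t)| ≤ C) {Z : (ℕ → Event) → ℝ}
    (hZ : ∀ e t, n + 2 ≤ (summary n₁ n e t).cycle → f (summary n₁ n e t) = Z e) :
    Integrable Z (miningLaw q γ) ∧ ∫ e, Z e ∂miningLaw q γ = f Summary.init := by
  have hlim : ∀ᵐ e ∂miningLaw q γ, Filter.Tendsto (fun t => f (summary n₁ n e t)) Filter.atTop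
      (𝓝 (Z e)) := by
    filter_upwards [ae_exists_cycle q γ hq n₁ n] with e ⟨t, ht⟩
    refine tendsto_atTop_of_eventually_const (i₀ := t) fun s hs => hZ e s ?_
    exact ht.trans (cycle_mono n₁ n e hs)
  -- Measurability of `Z` is not assumed; it is inherited from the almost sure limit.
  have hmeas : AEStronglyMeasurable Z (miningLaw q γ) :=
    aestronglyMeasurable_of_tendsto_ae Filter.atTop
      (fun t => (measurable_comp_summary t f).aestronglyMeasurable) hlim
  have hbound : ∀ᵐ e ∂miningLaw q γ, ‖Z e‖ ≤ C := by
    filter_upwards [hlim] with e he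
    exact le_of_tendsto' he.norm fun t => hC e t
  refine ⟨Integrable.of_bound hmeas C hbound, ?_⟩
  have h := tendsto_integral_of_dominated_convergence (fun _ => C)
    (fun t => (measurable_comp_summary t f).aestronglyMeasurable) (integrable_const C)
    (fun t => Filter.Eventually.of_forall fun e => hC e t) hlim
  simp only [integral_summary_of_harmonic q γ f hf] at h
  exact tendsto_nhds_unique h tendsto_const_nhds

end Law

/-! ### Uniform bounds for dominated convergence, and the closed form -/

section Bounds

/-- The values of the counters which occur along a trajectory. -/
structure Summary.Bounded (n₁ n : ℕ) (x : Summary) : Prop where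
  pending : x.pending ≤ n₁
  count : x.count ≤ if x.cycle ≤ n + 1 then 1 else n₁ + 1
  fork : ∀ i fresh c, x.phase = Phase.fork i fresh c → c ≤ n₁ - (i + 2)

/-- Pending uncles in a fork phase were found at distinct larger leads, so their distances to the
next fork block are distinct numbers from `i + 3` to `n₁`; this gives the bound on `c`. -/
theorem Phase.next_bounded {n₁ : ℕ} {ph : Phase} {ev : Event}
    (h : ∀ i fresh c, ph = Phase.fork i fresh c → c ≤ n₁ - (i + 2)) :
    (∀ i fresh c, ph.next n₁ ev = Sum.inl (Phase.fork i fresh c) → c ≤ n₁ - (i + 2)) ∧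
      ∀ o, ph.next n₁ ev = Sum.inr o → o.pending ≤ n₁ ∧ o.own ≤ 1 := by
  obtain ⟨_ | _, coin⟩ := ev
  · match ph with
    | .agree => simp [Phase.next]
    | .lead =>
      simp only [Phase.next, Sum.inl.injEq, Phase.fork.injEq, reduceCtorEq, false_imp_iff,
        implies_true, and_true]
      rintro i fresh c ⟨-, -, rfl⟩
      exact Nat.zero_le _
    | .tie => simp [Phase.next]
    | .fork i fresh c =>
      simp only [Phase.next, Sum.inl.injEq, Phase.fork.injEq, reduceCtorEq, false_imp_iff,
        implies_true, and_true]
      rintro i fresh c ⟨-, -, rfl⟩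
      exact Nat.zero_le _
  · match ph with
    | .agree => simp [Phase.next]
    | .lead => simp [Phase.next]
    | .tie => simp [Phase.next]
    | .fork 0 fresh c =>
      have := h 0 fresh c rfl
      simp only [Phase.next, Sum.inr.injEq, reduceCtorEq, false_imp_iff, implies_true, true_and]
      rintro _ rfl
      refine ⟨?_, Nat.zero_le _⟩
      simp only [uncleWeight]
      split_ifs with h' <;> omega
    | .fork (i + 1) fresh c =>
      have := h (i + 1) fresh c rfl
      simp only [Phase.next, Sum.inl.injEq, Phase.fork.injEq, reduceCtorEq, false_imp_iff,
        implies_true, and_true]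
      rintro _ _ _ ⟨rfl, -, rfl⟩
      simp only [uncleWeight]
      split_ifs with h' <;> omega

theorem summary_bounded (n₁ n : ℕ) (e : ℕ → Event) (t : ℕ) :
    (summary n₁ n e t).Bounded n₁ n := by
  induction t with
  | zero => exact ⟨Nat.zero_le _, Nat.zero_le _, fun i fresh c h => by cases h⟩
  | succ t ih =>
    rw [summary]
    obtain ⟨b1, b2⟩ := Phase.next_bounded (ev := e t) ih.fork
    set x := summary n₁ n e t
    unfold Summary.step
    rcases hnext : x.phase.next n₁ (e t) with ph | o
    · exact ⟨ih.pending, ih.count, fun i fresh c h => b1 i fresh c (by rw [hnext, ← h])⟩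
    · obtain ⟨h1, h2⟩ := b2 o hnext
      have h3 := ih.pending
      have h4 := ih.count
      have hfin : (x.finish n o).pending ≤ n₁ ∧
          (x.finish n o).count ≤ if x.cycle + 1 ≤ n + 1 then 1 else n₁ + 1 := by
        unfold Summary.finish
        by_cases hn : x.cycle = n
        · rw [if_pos hn]
          refine ⟨h1, ?_⟩
          dsimp only
          split_ifs <;> omega
        · rw [if_neg hn]
          by_cases hn' : x.cycle = n + 1 ∧ o.honestFirst = true
          · rw [if_pos hn']
            refine ⟨h3, ?_⟩
            dsimp only
            split_ifs at h4 ⊢ <;> omega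
          · rw [if_neg hn']
            refine ⟨h3, ?_⟩
            dsimp only
            split_ifs at h4 ⊢ <;> omega
      refine ⟨hfin.1, ?_, fun i fresh c h => ?_⟩
      · rw [Summary.finish_cycle]
        exact hfin.2
      · rw [Summary.finish_phase] at h
        cases h

theorem mul_mem_Icc {a X M : ℝ} (ha : 0 ≤ a ∧ a ≤ 1) (hX : 0 ≤ X ∧ X ≤ M) :
    0 ≤ a * X ∧ a * X ≤ M :=
  ⟨mul_nonneg ha.1 hX.1, (mul_le_of_le_one_left hX.1 ha.2).trans hX.2⟩

variable {p q γ : ℝ}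

theorem pow_mul_pow_mem_Icc (hp : 0 ≤ p ∧ p ≤ 1) (hq : 0 ≤ q ∧ q ≤ 1) (k l : ℕ) :
    0 ≤ p ^ k * q ^ l ∧ p ^ k * q ^ l ≤ 1 :=
  mul_mem_Icc ⟨pow_nonneg hp.1 _, pow_le_one₀ hp.1 hp.2⟩ ⟨pow_nonneg hq.1 _, pow_le_one₀ hq.1 hq.2⟩

theorem finalRunSum_mem_Icc (hp : 0 ≤ p ∧ p ≤ 1) (hq : 0 ≤ q ∧ q ≤ 1) (n₁ m : ℕ) :
    0 ≤ finalRunSum n₁ p q m ∧ finalRunSum n₁ p q m ≤ n₁ * n₁ := by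
  refine ⟨Finset.sum_nonneg fun j _ => Finset.sum_nonneg fun k _ =>
    (pow_mul_pow_mem_Icc hp hq _ _).1, ?_⟩
  have hj : ∀ j ∈ Finset.range (n₁ - 1), finalRunProb p q m j ≤ n₁ := by
    intro j hj
    refine (Finset.sum_le_card_nsmul _ _ 1 fun k _ => (pow_mul_pow_mem_Icc hp hq _ _).2).trans ?_
    rw [Finset.mem_range] at hj
    rw [Finset.card_range, nsmul_one, Nat.cast_le]
    omega
  refine (Finset.sum_le_card_nsmul _ _ _ hj).trans ?_
  rw [Finset.card_range, nsmul_eq_mul]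
  gcongr
  omega

theorem singleRunSum_mem_Icc (hp : 0 ≤ p ∧ p ≤ 1) (hq : 0 ≤ q ∧ q ≤ 1) (n₁ i : ℕ) :
    0 ≤ singleRunSum n₁ p q i ∧ singleRunSum n₁ p q i ≤ n₁ := by
  refine ⟨Finset.sum_nonneg fun l _ => (pow_mul_pow_mem_Icc hq hp _ _).1, ?_⟩
  refine (Finset.sum_le_card_nsmul _ _ 1 fun l _ => (pow_mul_pow_mem_Icc hq hp _ _).2).trans ?_
  rw [Finset.card_range, nsmul_one, Nat.cast_le]
  omega

theorem pendingMean_mem_Icc (hq : 0 ≤ q ∧ q ≤ 1) (hγ : 0 ≤ γ ∧ γ ≤ 1) {n₁ : ℕ} {ph : Phase}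
    (h : ∀ i fresh c, ph = Phase.fork i fresh c → c ≤ n₁ - (i + 2)) :
    0 ≤ pendingMean n₁ q γ ph ∧ pendingMean n₁ q γ ph ≤ n₁ + n₁ * n₁ + n₁ := by
  have hp : 0 ≤ 1 - q ∧ 1 - q ≤ 1 := ⟨by linarith, by linarith⟩
  have hγ' : 0 ≤ 1 - γ ∧ 1 - γ ≤ 1 := ⟨by linarith, by linarith⟩
  have h1 := fun m => mul_mem_Icc hγ (finalRunSum_mem_Icc hp hq n₁ m)
  have h2 := fun i => mul_mem_Icc hγ' (singleRunSum_mem_Icc hp hq n₁ i)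
  have h3 := mul_mem_Icc hq ⟨add_nonneg (h1 1).1 (h2 0).1, add_le_add (h1 1).2 (h2 0).2⟩
  have h4 := mul_mem_Icc hq h3
  have h0 : (0 : ℝ) ≤ n₁ := Nat.cast_nonneg _
  match ph with
  | .agree => exact ⟨h4.1, by simp only [pendingMean]; linarith⟩
  | .lead => exact ⟨h3.1, by simp only [pendingMean]; linarith⟩
  | .tie => exact ⟨le_rfl, by simp only [pendingMean]; positivity⟩
  | .fork i fresh c =>
    have hc : (c : ℝ) ≤ n₁ := by
      have := h i fresh c rfl
      exact_mod_cast (by omega : c ≤ n₁)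
    have h5 := mul_mem_Icc (a := (1 - q) ^ (i + 1))
      ⟨pow_nonneg hp.1 _, pow_le_one₀ hp.1 hp.2⟩ ⟨Nat.cast_nonneg c, hc⟩
    have h6 := h1 (i + 1)
    have h7 := h2 i
    simp only [pendingMean]
    split_ifs
    · exact ⟨by linarith, by linarith⟩
    · exact ⟨by linarith, by linarith⟩

theorem ownMean_mem_Icc (hq : 0 ≤ q ∧ q ≤ 1) (ph : Phase) :
    0 ≤ ownMean q ph ∧ ownMean q ph ≤ 1 := by
  have hp : 0 ≤ 1 - q ∧ 1 - q ≤ 1 := ⟨by linarith, by linarith⟩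
  have hp2 : 0 ≤ (1 - q) ^ 2 ∧ (1 - q) ^ 2 ≤ 1 := ⟨pow_nonneg hp.1 _, pow_le_one₀ hp.1 hp.2⟩
  cases ph
  · exact mul_mem_Icc hq hp2
  · exact hp2
  · exact hp
  · exact ⟨le_rfl, zero_le_one⟩

theorem firstMean_mem_Icc (hq : 0 ≤ q ∧ q ≤ 1) (hγ : 0 ≤ γ ∧ γ ≤ 1) (ph : Phase) :
    0 ≤ firstMean q γ ph ∧ firstMean q γ ph ≤ 1 := by
  have hp : 0 ≤ 1 - q ∧ 1 - q ≤ 1 := ⟨by linarith, by linarith⟩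
  have hγ' : 0 ≤ 1 - γ ∧ 1 - γ ≤ 1 := ⟨by linarith, by linarith⟩
  have hp2 : 0 ≤ (1 - q) ^ 2 ∧ (1 - q) ^ 2 ≤ 1 := ⟨pow_nonneg hp.1 _, pow_le_one₀ hp.1 hp.2⟩
  have h1 := mul_mem_Icc hp2 hγ'
  have h2 := mul_mem_Icc hq h1
  cases ph
  · simp only [firstMean]
    have h3 := mul_mem_Icc hq h1
    have h4 := mul_le_of_le_one_right hq.1 h1.2
    exact ⟨by linarith, by linarith⟩
  · exact h1
  · exact mul_mem_Icc hp hγ'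
  · exact ⟨le_rfl, zero_le_one⟩

theorem abs_laterMean_le (hq : 0 ≤ q ∧ q ≤ 1) (hγ : 0 ≤ γ ∧ γ ≤ 1) (n₁ n : ℕ) (e : ℕ → Event)
    (t : ℕ) : |laterMean n₁ n q γ (summary n₁ n e t)| ≤ n₁ + n₁ * n₁ + n₁ := by
  have hb := summary_bounded n₁ n e t
  have h1 := pendingMean_mem_Icc (n₁ := n₁) (ph := Phase.agree) hq hγ (fun i f c h => by cases h)
  have h2 := pendingMean_mem_Icc hq hγ hb.fork
  have h3 : ((summary n₁ n e t).pending : ℝ) ≤ n₁ := by exact_mod_cast hb.pending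
  have h4 : (0 : ℝ) ≤ (summary n₁ n e t).pending := Nat.cast_nonneg _
  have h5 : (0 : ℝ) ≤ n₁ * n₁ := by positivity
  rw [abs_le]
  unfold laterMean
  split_ifs <;> constructor <;> linarith

theorem abs_honestMean_le (hq : 0 ≤ q ∧ q ≤ 1) (hγ : 0 ≤ γ ∧ γ ≤ 1) (n₁ n : ℕ) (e : ℕ → Event)
    (t : ℕ) :
    |honestMean n₁ n q γ (summary n₁ n e t)| ≤ 1 + (n₁ + n₁ * n₁ + n₁) := by
  have hb := summary_bounded n₁ n e t
  have h1 := mul_mem_Icc (firstMean_mem_Icc hq hγ Phase.agree) <|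
    pendingMean_mem_Icc (n₁ := n₁) (ph := Phase.agree) hq hγ (fun i f c h => by cases h)
  have h2 := mul_mem_Icc (firstMean_mem_Icc hq hγ Phase.agree) <|
    pendingMean_mem_Icc hq hγ hb.fork
  have h3 := mul_mem_Icc (firstMean_mem_Icc hq hγ (summary n₁ n e t).phase)
    (X := (summary n₁ n e t).pending) (M := n₁) ⟨Nat.cast_nonneg _, by exact_mod_cast hb.pending⟩
  have h4 : (0 : ℝ) ≤ (summary n₁ n e t).count := Nat.cast_nonneg _
  have h5 : (0 : ℝ) ≤ n₁ * n₁ := by positivity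
  have h6 := ownMean_mem_Icc hq Phase.agree
  have h7 := ownMean_mem_Icc hq (summary n₁ n e t).phase
  have h8 := hb.count
  rw [mul_comm] at h3
  have h9 : ((summary n₁ n e t).count : ℝ) ≤ 1 + n₁ := by
    have : (summary n₁ n e t).count ≤ 1 + n₁ := by split_ifs at h8 <;> omega
    exact_mod_cast this
  rw [abs_le]
  unfold honestMean
  split_ifs <;> constructor <;> linarith

/-- After two secret blocks `m = 1`, so only the term `k = 0` of `finalRunProb` remains, equal to `q
^ j`; the other sum has ratio `(1 - q) * q`. -/
theorem pendingMean_agree (hq : q < 1) (hpq : (1 - q) * q ≠ 1) (n₁ : ℕ) (γ : ℝ) :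
    pendingMean n₁ q γ Phase.agree = q ^ 2 / (1 - q) * (1 - q ^ (n₁ - 1)) * γ +
      (1 - γ) * (1 - q) * q ^ 2 * ((1 - ((1 - q) * q) ^ (n₁ - 1)) / (1 - (1 - q) * q)) := by
  have h1 : finalRunSum n₁ (1 - q) q 1 = (1 - q ^ (n₁ - 1)) / (1 - q) := by
    have : finalRunSum n₁ (1 - q) q 1 = ∑ j ∈ Finset.range (n₁ - 1), q ^ j := by
      unfold finalRunSum finalRunProb
      refine Finset.sum_congr rfl fun j _ => ?_
      rw [min_eq_left (by omega)]
      simp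
    rw [this, geom_sum_eq hq.ne, ← neg_div_neg_eq, neg_sub, neg_sub]
  have h2 : singleRunSum n₁ (1 - q) q 0 =
      (1 - q) * ((1 - ((1 - q) * q) ^ (n₁ - 1)) / (1 - (1 - q) * q)) := by
    have : singleRunSum n₁ (1 - q) q 0 =
        (1 - q) * ∑ l ∈ Finset.range (n₁ - 1), ((1 - q) * q) ^ l := by
      unfold singleRunSum
      rw [Finset.mul_sum]
      refine Finset.sum_congr rfl fun l _ => ?_
      rw [mul_pow]
      ring
    rw [this, geom_sum_eq hpq, ← neg_div_neg_eq, neg_sub, neg_sub]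
  rw [pendingMean, h1, h2]
  ring

end Bounds

end SelfishMining

/-! ### The theorem: both harmonic functions evaluated at the initial summary -/

theorem mainTheorem4 (q γ : unitInterval) (hq : (q : ℝ) < 1 / 2) (p : ℝ) (hp : p = 1 - q)
    (n₁ : ℕ) (hn₁ : 1 ≤ n₁) (n : ℕ) :
    MeasureTheory.Integrable
        (fun e => (SelfishMining.laterReferredUncles n₁ n e : ℝ)) (SelfishMining.miningLaw q γ) ∧
      MeasureTheory.Integrable
        (fun e => (SelfishMining.honestReferredUncles n₁ n e : ℝ)) (SelfishMining.miningLaw q γ) ∧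
      (∫ e, (SelfishMining.laterReferredUncles n₁ n e : ℝ) ∂(SelfishMining.miningLaw q γ)) =
        (q : ℝ) ^ 2 / p * (1 - (q : ℝ) ^ (n₁ - 1)) * γ +
          (1 - (γ : ℝ)) * p * (q : ℝ) ^ 2 *
            ((1 - (p * q) ^ (n₁ - 1)) / (1 - p * q)) ∧
      (∫ e, (SelfishMining.honestReferredUncles n₁ n e : ℝ) ∂(SelfishMining.miningLaw q γ)) =
        p ^ 2 * q + (p + (1 - (γ : ℝ)) * p ^ 2 * q) *
          ∫ e, (SelfishMining.laterReferredUncles n₁ n e : ℝ) ∂(SelfishMining.miningLaw q γ) := by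
  subst hp
  have hq' : 0 ≤ (q : ℝ) ∧ (q : ℝ) ≤ 1 := q.2
  have hγ' : 0 ≤ (γ : ℝ) ∧ (γ : ℝ) ≤ 1 := γ.2
  obtain ⟨hV, hV'⟩ := SelfishMining.integral_eq_of_harmonic q γ hq
    (SelfishMining.eventMean_laterMean n₁ n q γ)
    (SelfishMining.abs_laterMean_le hq' hγ' n₁ n)
    (Z := fun e => (SelfishMining.laterReferredUncles n₁ n e : ℝ)) (by
      intro e t ht
      rw [(SelfishMining.referredUncles_eq hn₁ ht).1, SelfishMining.laterMean,
        if_neg (by omega), if_neg (by omega)])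
  obtain ⟨hU, hU'⟩ := SelfishMining.integral_eq_of_harmonic q γ hq
    (SelfishMining.eventMean_honestMean n₁ n q γ)
    (SelfishMining.abs_honestMean_le hq' hγ' n₁ n)
    (Z := fun e => (SelfishMining.honestReferredUncles n₁ n e : ℝ)) (by
      intro e t ht
      rw [(SelfishMining.referredUncles_eq hn₁ ht).2, SelfishMining.honestMean,
        if_neg (by omega), if_neg (by omega), if_neg (by omega)])
  have hV0 : SelfishMining.laterMean n₁ n q γ SelfishMining.Summary.init =
      SelfishMining.pendingMean n₁ q γ SelfishMining.Phase.agree := by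
    unfold SelfishMining.laterMean
    split_ifs with h1 h2
    · rfl
    · rfl
    · exact absurd (Nat.eq_zero_of_not_pos h1).symm h2
  have hU0 : SelfishMining.honestMean n₁ n q γ SelfishMining.Summary.init =
      SelfishMining.ownMean q SelfishMining.Phase.agree +
        SelfishMining.firstMean q γ SelfishMining.Phase.agree *
          SelfishMining.pendingMean n₁ q γ SelfishMining.Phase.agree := by
    unfold SelfishMining.honestMean
    split_ifs with h1 h2
    · rfl
    · rfl
    · exact absurd (Nat.eq_zero_of_not_pos h1).symm h2
    · exact absurd (Nat.eq_zero_of_not_pos h1).symm h2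
  refine ⟨hV, hU, ?_, ?_⟩
  · rw [hV', hV0, SelfishMining.pendingMean_agree (by linarith)]
    -- The remaining goal is that the ratio `(1 - q) * q` of the second geometric sum is not `1`.
    nlinarith [hq'.1]
  · rw [hV', hU', hV0, hU0]
    simp only [SelfishMining.ownMean, SelfishMining.firstMean]
    ring
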